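/- Let $x=(x_1,\dots,x_N)\in\mathbb{R}^N$ with all $x_t\ge 0$ and at most $K$ nonzero coordinates; let $0<\gamma\le 1$, $\epsilon>0$, $M\ge 0$ and $1\le i\le N$. For $0<\alpha<1$ let $S(\alpha,1,1)$ be the maximally skewed $\alpha$-stable law with unit scale, i.e. the probability law on $\mathbb{R}$ with characteristic function $t\mapsto \exp\left(-|t|^\alpha\left(1-\sqrt{-1}\,\mathrm{sign}(t)\tan\frac{\pi\alpha}{2}\right)\right)$. Let $s_{tj}\sim S(\alpha,1,1)$ and $r_{tj}\in\{0,1\}$ with $\Pr(r_{tj}=1)=\gamma$, $\Pr(r_{tj}=0)=1-\gamma$ ($1\le t\le N$, $1\le j\le M$), all of these variables being independent. Put $$y_j=\sum_{t=1}^N x_t s_{tj}r_{tj},\qquad T_i=\{j: r_{ij}=1\},\qquad \hat x_i=\min_{j\in T_i}\frac{y_j}{s_{ij}r_{ij}},\qquad \eta_{ij}=\sum_{t\ne i}x_t^\alpha r_{tj},$$ where $\hat x_i=+\infty$ if $T_i=\emptyset$. For independent $S_1,S_2\sim S(\alpha,1,1)$ let $F_\alpha(t)=\Pr\left((S_2/S_1)^{\alpha/(1-\alpha)}\le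 t\right)$ for $t\in[0,\infty]$, so that $F_\alpha(\infty)=1$. A positive number divided by $0$ is read as $\infty$, and $\tan^{-1}(\infty)=\pi/2$. (1) For every $0<\alpha<1$ and every $1\le j\le M$, $$\Pr(\hat x_i>x_i+\epsilon)=\left[1-\gamma\,E\left\{F_\alpha\left(\left(\frac{\epsilon^\alpha}{\eta_{ij}}\right)^{1/(1-\alpha)}\right)\right\}\right]^M .$$ (2) With $x,\gamma,\epsilon,M,i$ fixed, the limit of $\Pr(\hat x_i>x_i+\epsilon)$ as $\alpha\to0+$ exists, and $$\lim_{\alpha\to0+}\Pr(\hat x_i>x_i+\epsilon)\le\left[1-\frac{1}{1/\gamma+K-1+1_{x_i=0}}\right]^M\le\left[1-\frac{1}{1/\gamma+K}\right]^M .$$ (3) If $\alpha=1/2$, then $$\Pr(\hat x_i>x_i+\epsilon)\le\left[1-\gamma\frac{2}{\pi}\tan^{-1}\left(\frac{\sqrt{\epsilon}}{\gamma\sum_{t\ne i}x_t^{1/2}}\right)\right]^M\le\left[1-\gamma\frac{2}{\pi}\tan^{-1}\left(\frac{\sqrt{\epsilon}}{\gamma\sum_{t=1}^N x_t^{1/2}}\right)\right]^M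 .$$ -/

import Mathlib

open MeasureTheory ProbabilityTheory Filter Topology
open scoped ENNReal

namespace CompressedCounting

/-- `μ` is the law `S(α,1,1)`, for `0 < α < 1`: the `α`-stable distribution with skewness `1` and
unit scale, i.e. the probability measure on `ℝ` with characteristic function
`exp (-|t|^α (1 - i sign(t) tan(πα/2)))`. -/
structure IsMaxSkewedStable (α : ℝ) (μ : Measure ℝ) : Prop where
  isProbabilityMeasure : IsProbabilityMeasure μ
  charFun_eq : ∀ t : ℝ, charFun μ t =
    Complex.exp (-((|t| ^ α : ℝ) : ℂ) *
      (1 - Complex.I * ((Real.sign t * Real.tan (Real.pi * α / 2) : ℝ) : ℂ)))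

/-- The law `S(α,1,1)` as a measure: the one and only `μ` with `IsMaxSkewedStable α μ`. -/
noncomputable def stableLaw (α : ℝ) : Measure ℝ :=
  Classical.epsilon (IsMaxSkewedStable α)

theorem IsMaxSkewedStable.eq_stableLaw {α : ℝ} {μ : Measure ℝ} (h : IsMaxSkewedStable α μ) :
    μ = stableLaw α := by
  have h' : IsMaxSkewedStable α (stableLaw α) :=
    Classical.epsilon_spec (p := IsMaxSkewedStable α) ⟨μ, h⟩
  have := h.isProbabilityMeasure
  have := h'.isProbabilityMeasure
  apply Measure.ext_of_charFun
  funext t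
  rw [h.charFun_eq, h'.charFun_eq]

/-- `F_α(t) = Pr ((S₂ / S₁)^(α/(1-α)) ≤ t)` for independent `S₁, S₂ ∼ S(α,1,1)` and `t ∈ [0,∞]`.
The value `t = ∞` is allowed, so that `F_α(∞) = 1`. -/
noncomputable def ratioCDF (α : ℝ) (t : ℝ≥0∞) : ℝ :=
  ((stableLaw α).prod (stableLaw α)).real
    {p : ℝ × ℝ | ENNReal.ofReal ((p.2 / p.1) ^ (α / (1 - α))) ≤ t}

section Design

variable {N M : ℕ} {Ω : Type*}

/-- The random very sparse design: `s i j ∼ S(α,1,1)`, `r i j` is `1` with probability `γ` and `0`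
with probability `1 - γ`, and all these `2 N M` random variables are independent. -/
structure IsSparseDesign [MeasurableSpace Ω] (α γ : ℝ) (P : Measure Ω)
    (s r : Fin N → Fin M → Ω → ℝ) : Prop where
  isProbabilityMeasure : IsProbabilityMeasure P
  measurable_s : ∀ i j, Measurable (s i j)
  measurable_r : ∀ i j, Measurable (r i j)
  law_s : ∀ i j, IsMaxSkewedStable α (P.map (s i j))
  prob_r_one : ∀ i j, P {ω | r i j ω = 1} = ENNReal.ofReal γ
  prob_r_zero : ∀ i j, P {ω | r i j ω = 0} = ENNReal.ofReal (1 - γ)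
  indep : iIndepFun
    (Sum.elim (fun p : Fin N × Fin M => s p.1 p.2) (fun p : Fin N × Fin M => r p.1 p.2)) P

/-- The measurements `y_j = ∑ t, x_t s_{tj} r_{tj}`. -/
def measurement (x : Fin N → ℝ) (s r : Fin N → Fin M → Ω → ℝ) (j : Fin M) (ω : Ω) : ℝ :=
  ∑ t, x t * (s t j ω * r t j ω)

/-- The estimator: the minimum of `y_j / (s_{ij} r_{ij})` over `T_i = {j | r_{ij} = 1}`, which is
`+∞` when `T_i` is empty. -/
noncomputable def estimator (x : Fin N → ℝ) (s r : Fin N → Fin M → Ω → ℝ) (i : Fin N) (ω : Ω) :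
    EReal :=
  ⨅ j ∈ {j : Fin M | r i j ω = 1},
    ((measurement x s r j ω / (s i j ω * r i j ω) : ℝ) : EReal)

/-- The error probability `Pr (x̂_i > x_i + ε)`. -/
noncomputable def errorProb [MeasurableSpace Ω] (P : Measure Ω) (x : Fin N → ℝ)
    (s r : Fin N → Fin M → Ω → ℝ) (i : Fin N) (ε : ℝ) : ℝ :=
  P.real {ω | ((x i + ε : ℝ) : EReal) < estimator x s r i ω}

/-- `η_{ij} = ∑_{t ≠ i} x_t^α r_{tj}`. -/
noncomputable def eta (α : ℝ) (x : Fin N → ℝ) (r : Fin N → Fin M → Ω → ℝ) (i : Fin N) (j : Fin M)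
    (ω : Ω) : ℝ :=
  ∑ t ∈ Finset.univ.erase i, x t ^ α * r t j ω

end Design

/-- The arctangent on `[0,∞]`, with `arctan ∞ = π/2`. -/
noncomputable def arctanTop (t : ℝ≥0∞) : ℝ :=
  if t = ∞ then Real.pi / 2 else Real.arctan t.toReal

end CompressedCounting

namespace CompressedCounting

open Set

/-! ### Mean values of bounded holomorphic functions on the right half-plane -/

/-! After subtracting `x i`, column `j` pushes the estimate down to `x i + ε` exactly when `r i j =
1` and `(∑_{t≠i} x_t r_tj s_tj) / s_ij ≤ ε`. Given the Bernoulli entries, stability makes the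
numerator a copy of `η^(1/α) S₂` independent of `S₁ = s_ij`, so the conditional probability is
`ratioProb α ε η`. Since `S₁, S₂ > 0` almost surely, powers may be taken and this is a value of
`F_α`. Independence of `r_ij` from `η` gives the factor `γ`, and the `M` independent columns give
the power (`errorProb_eq`).

Only the characteristic function of `S(α,1,1)` is given, so positivity and the Laplace transform
have to be derived. The characteristic function is the boundary value on the imaginary axis of
`stableLaplace`, a bounded holomorphic function on the right half-plane. Poisson's formula there
(`halfPlane_mean_value`) averages it against a Cauchy law and yields `E exp(-l|S|)`. By uniqueness
`|S|` has the law of `S`, whence `S ≥ 0`.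

As `α → 0+`, `exp (-v^(1/α) y)` approximates the indicator of `v y^α < 1`, so Laplace transforms
determine the limits of powers: `S^(-α)` becomes exponential and `(S₂/S₁)^α` a quotient of two
independent exponentials, giving `1/(1+k)`, where `k` counts the active nonzero coordinates other
than `i`. Convexity in `k` gives the bound.

At `α = 1/2` one has `S = 1/Z²` with `Z` Gaussian, so `S₂/S₁` is the square of a Cauchy variable;
the probability is an arctangent, and concavity gives the bound.

Existence of `S(α,1,1)` is read off the design, except at `α = 1/2`, where the law is constructed.
-/

lemma re_one_sub_div_one_add (w : ℂ) :
    ((1 - w) / (1 + w)).re = (1 - ‖w‖ ^ 2) / ‖1 + w‖ ^ 2 := by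
  rw [Complex.div_re, ← Complex.normSq_eq_norm_sq, ← Complex.normSq_eq_norm_sq, ← add_div]
  congr 1
  simp [Complex.normSq_apply]
  ring

lemma one_sub_div_one_add_exp {θ : ℝ} (hθ : θ ∈ Ioo (-Real.pi) Real.pi) :
    1 + Complex.exp (θ * Complex.I) ≠ 0 ∧
    (1 - Complex.exp (θ * Complex.I)) / (1 + Complex.exp (θ * Complex.I)) =
      -((Real.tan (θ / 2) : ℝ) : ℂ) * Complex.I := by
  have hc : Complex.cos (θ / 2) ≠ 0 := by
    have : 0 < Real.cos (θ / 2) :=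
      Real.cos_pos_of_mem_Ioo ⟨by linarith [hθ.1], by linarith [hθ.2]⟩
    exact_mod_cast this.ne'
  set e := Complex.exp ((θ / 2 : ℂ) * Complex.I) with he
  have hee : Complex.exp (θ * Complex.I) = e * e := by
    rw [he, ← Complex.exp_add]; congr 1; ring
  have he1 : e = Complex.cos (θ / 2) + Complex.sin (θ / 2) * Complex.I := Complex.exp_mul_I _
  have he0 : e ≠ 0 := Complex.exp_ne_zero _
  have hsc := Complex.sin_sq_add_cos_sq (θ / 2 : ℂ)
  have hI := Complex.I_sq
  have h1 : 1 + e * e = 2 * Complex.cos (θ / 2) * e := by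
    rw [he1]
    linear_combination (-1 : ℂ) * hsc + Complex.sin (θ / 2) ^ 2 * hI
  have h2 : 1 - e * e = -(2 * Complex.sin (θ / 2) * Complex.I) * e := by
    rw [he1]
    linear_combination (-1 : ℂ) * hsc + Complex.sin (θ / 2) ^ 2 * hI
  rw [hee]
  have h3 : 1 + e * e ≠ 0 := by rw [h1]; simp [hc, he0]
  refine ⟨h3, ?_⟩
  rw [div_eq_iff h3, h1, h2, Complex.ofReal_tan, Complex.tan_eq_sin_div_cos]
  push_cast
  field_simp

/-- Poisson's formula at the point `l`, transported from the disc: apply the mean value property on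
circles of radius `R < 1` and let `R → 1` by dominated convergence. -/
theorem halfPlane_mean_value {g : ℂ → ℂ} (hd : DifferentiableOn ℂ g {z | 0 < z.re})
    (hc : ContinuousOn g {z | 0 ≤ z.re}) (hb : ∀ z : ℂ, 0 < z.re → ‖g z‖ ≤ 1)
    {l : ℝ} (hl : 0 < l) :
    (2 * Real.pi)⁻¹ • ∫ θ in -Real.pi..Real.pi,
      g (((-(l * Real.tan (θ / 2)) : ℝ) : ℂ) * Complex.I) = g l := by
  -- Cayley map from the unit disc to the right half-plane, taking `0` to `l` and the circle without
  -- `-1` to the imaginary axis.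
  set m : ℂ → ℂ := fun w => l * ((1 - w) / (1 + w)) with hm
  have hmre : ∀ w : ℂ, (m w).re = l * ((1 - ‖w‖ ^ 2) / ‖1 + w‖ ^ 2) := fun w => by
    rw [hm]; simp only [Complex.re_ofReal_mul, re_one_sub_div_one_add]
  have hne : ∀ w : ℂ, ‖w‖ < 1 → 1 + w ≠ 0 := fun w hw h => by
    have : w = -1 := by linear_combination h
    rw [this] at hw; simp at hw
  have hpos : ∀ w : ℂ, ‖w‖ < 1 → 0 < (m w).re := fun w hw => by
    rw [hmre]
    have h1 : 0 < ‖1 + w‖ := norm_pos_iff.2 (hne w hw)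
    have h2 : 0 < 1 - ‖w‖ ^ 2 := by nlinarith [norm_nonneg w]
    positivity
  have hfd : DifferentiableOn ℂ (fun w => g (m w)) (Metric.ball 0 1) := by
    refine hd.comp (t := {z | 0 < z.re}) ?_ fun w hw => hpos w (by simpa using hw)
    intro w hw
    have := hne w (by simpa using hw)
    exact DifferentiableAt.differentiableWithinAt (by rw [hm]; fun_prop (disch := assumption))
  have hmean : ∀ R ∈ Ioo (0 : ℝ) 1,
      (2 * Real.pi)⁻¹ • ∫ θ in -Real.pi..Real.pi, g (m (circleMap 0 R θ)) = g l := by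
    intro R hR
    have h1 : DiffContOnCl ℂ (fun w => g (m w)) (Metric.ball 0 |R|) := by
      apply DifferentiableOn.diffContOnCl
      refine hfd.mono ?_
      rw [abs_of_pos hR.1, closure_ball _ hR.1.ne']
      exact Metric.closedBall_subset_ball hR.2
    have h2 := h1.circleAverage
    rw [Real.circleAverage_def] at h2
    have h3 : Function.Periodic (fun θ => g (m (circleMap 0 R θ))) (2 * Real.pi) := fun θ => by
      simp only [periodic_circleMap 0 R θ]
    have h4 := h3.intervalIntegral_add_eq (-Real.pi) 0
    rw [show -Real.pi + 2 * Real.pi = Real.pi by ring, zero_add] at h4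
    rw [h4, h2]
    simp [hm]
  have hlim : Tendsto (fun R : ℝ => ∫ θ in -Real.pi..Real.pi, g (m (circleMap 0 R θ)))
      (𝓝[<] 1) (𝓝 (∫ θ in -Real.pi..Real.pi,
        g (((-(l * Real.tan (θ / 2)) : ℝ) : ℂ) * Complex.I))) := by
    have hev : ∀ᶠ R : ℝ in 𝓝[<] 1, R ∈ Ioo (0 : ℝ) 1 :=
      Ioo_mem_nhdsLT (by norm_num)
    have hnorm : ∀ R ∈ Ioo (0 : ℝ) 1, ∀ θ : ℝ, ‖circleMap 0 R θ‖ < 1 := fun R hR θ => by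
      simp [circleMap, abs_of_pos hR.1, hR.2]
    refine intervalIntegral.tendsto_integral_filter_of_dominated_convergence (fun _ => 1) ?_ ?_
      intervalIntegrable_const ?_
    · filter_upwards [hev] with R hR
      refine Continuous.aestronglyMeasurable ?_
      refine continuous_iff_continuousAt.2 fun θ => ?_
      have h1 : ContinuousAt (fun w => g (m w)) (circleMap 0 R θ) :=
        (hfd.continuousOn).continuousAt
          (Metric.isOpen_ball.mem_nhds (by simpa using hnorm R hR θ))
      exact ContinuousAt.comp (f := circleMap 0 R) h1 (continuous_circleMap 0 R).continuousAt
    · filter_upwards [hev] with R hR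
      exact Eventually.of_forall fun θ _ => hb _ (hpos _ (hnorm R hR θ))
    -- The angle `π` corresponds to the pole `-1` of the Cayley map; it is a null set.
    · have hae : ∀ᵐ θ : ℝ, θ ≠ Real.pi := by
        simp [ae_iff, measure_singleton]
      filter_upwards [hae] with θ hθ1 hθ2
      rw [uIoc_of_le (by linarith [Real.pi_pos])] at hθ2
      have hθ : θ ∈ Ioo (-Real.pi) Real.pi := ⟨hθ2.1, lt_of_le_of_ne hθ2.2 hθ1⟩
      obtain ⟨h0, h1⟩ := one_sub_div_one_add_exp hθ
      have hval : m (circleMap 0 1 θ) = ((-(l * Real.tan (θ / 2)) : ℝ) : ℂ) * Complex.I := by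
        simp only [hm, circleMap, Complex.ofReal_one, one_mul, zero_add, h1]
        push_cast; ring
      have hcm : ContinuousAt (fun R : ℝ => m (circleMap 0 R θ)) 1 := by
        simp only [hm, circleMap, zero_add]
        have h0' : 1 + ((1 : ℝ) : ℂ) * Complex.exp (θ * Complex.I) ≠ 0 := by simpa using h0
        fun_prop (disch := assumption)
      rw [← hval]
      have hw : ContinuousWithinAt g {z | 0 ≤ z.re} (m (circleMap 0 1 θ)) := by
        apply hc
        rw [hval, mem_ofPred_eq, Complex.re_ofReal_mul]; simp
      refine hw.tendsto.comp ?_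
      refine tendsto_nhdsWithin_iff.2 ⟨hcm.tendsto.mono_left nhdsWithin_le_nhds, ?_⟩
      filter_upwards [hev] with R hR
      exact (hpos _ (hnorm R hR θ)).le
  have hconst : Tendsto (fun R : ℝ => (2 * Real.pi)⁻¹ •
      ∫ θ in -Real.pi..Real.pi, g (m (circleMap 0 R θ))) (𝓝[<] 1) (𝓝 (g l)) := by
    refine tendsto_const_nhds.congr' ?_
    filter_upwards [Ioo_mem_nhdsLT (show (0 : ℝ) < 1 by norm_num)] with R hR
    exact (hmean R hR).symm
  exact tendsto_nhds_unique (hlim.const_smul _) hconst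

/-- The characteristic function of the standard Cauchy law, parametrised by the angle. -/
theorem integral_exp_tan_half (u : ℝ) :
    (2 * Real.pi)⁻¹ • ∫ θ in -Real.pi..Real.pi,
      Complex.exp (((u * Real.tan (θ / 2) : ℝ) : ℂ) * Complex.I) = Real.exp (-|u|) := by
  have key : ∀ v : ℝ, 0 ≤ v → (2 * Real.pi)⁻¹ • ∫ θ in -Real.pi..Real.pi,
      Complex.exp (((v * Real.tan (θ / 2) : ℝ) : ℂ) * Complex.I) = Real.exp (-v) := by
    intro v hv
    have := halfPlane_mean_value (g := fun z => Complex.exp (-(z * v)))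
      (by fun_prop) (by fun_prop) (fun z hz => by
        rw [Complex.norm_exp]
        simpa using mul_nonneg hz.le hv) one_pos
    convert this using 4
    · push_cast; ring_nf
    · push_cast; simp
  rcases le_total 0 u with hu | hu
  · rw [abs_of_nonneg hu, key u hu]
  · rw [abs_of_nonpos hu, neg_neg, ← neg_neg u, ← key (-u) (by linarith)]
    congr 1
    have h := intervalIntegral.integral_comp_neg (a := -Real.pi) (b := Real.pi)
      fun θ => Complex.exp (((-u * Real.tan (θ / 2) : ℝ) : ℂ) * Complex.I)
    rw [neg_neg] at h
    rw [← h]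
    congr 1 with θ
    simp [neg_div, Real.tan_neg]

/-! ### Laplace transform and positivity of `S(α,1,1)` -/

/-- The holomorphic extension to the right half-plane of the Laplace transform of `S(α,1,1)`. -/
noncomputable def stableLaplace (α : ℝ) (z : ℂ) : ℂ :=
  Complex.exp (-(z ^ (α : ℂ) / (Real.cos (Real.pi * α / 2) : ℝ)))

lemma cos_half_pi_mul_pos {α : ℝ} (h0 : 0 < α) (h1 : α < 1) : 0 < Real.cos (Real.pi * α / 2) :=
  Real.cos_pos_of_mem_Ioo ⟨by nlinarith [Real.pi_pos], by nlinarith [Real.pi_pos]⟩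

/-- Since `|arg z| ≤ π/2` and `α < 1`, the argument of `z ^ α` stays within `π/2` of zero, so its
real part is nonnegative. -/
lemma norm_stableLaplace_le_one {α : ℝ} (h0 : 0 < α) (h1 : α < 1) {z : ℂ} (hz : 0 < z.re) :
    ‖stableLaplace α z‖ ≤ 1 := by
  have hc := cos_half_pi_mul_pos h0 h1
  rw [stableLaplace, Complex.norm_exp, Real.exp_le_one_iff, Complex.neg_re, Complex.div_ofReal_re,
    Complex.cpow_ofReal_re, neg_nonpos]
  have ha := Complex.abs_arg_le_pi_div_two_iff.2 hz.le
  have hcos : 0 ≤ Real.cos (z.arg * α) := by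
    rw [abs_le] at ha
    apply Real.cos_nonneg_of_mem_Icc
    constructor <;> nlinarith [Real.pi_pos]
  positivity

lemma differentiableOn_stableLaplace (α : ℝ) :
    DifferentiableOn ℂ (stableLaplace α) {z | 0 < z.re} := by
  intro z hz
  have : z ∈ Complex.slitPlane := Or.inl hz
  unfold stableLaplace
  apply DifferentiableAt.differentiableWithinAt
  have h : DifferentiableAt ℂ (fun z : ℂ => z ^ (α : ℂ)) z :=
    differentiableAt_id.cpow_const this
  fun_prop

lemma continuousOn_stableLaplace {α : ℝ} (h0 : 0 < α) :
    ContinuousOn (stableLaplace α) {z | 0 ≤ z.re} := by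
  intro z hz
  have h : ContinuousAt (fun z : ℂ => z ^ (α : ℂ)) z :=
    Complex.continuousAt_cpow_const_of_re_pos (Or.inl hz) (by simpa using h0)
  unfold stableLaplace
  apply ContinuousAt.continuousWithinAt
  fun_prop

lemma stableLaplace_ofReal (α : ℝ) {l : ℝ} (hl : 0 ≤ l) :
    stableLaplace α l = (Real.exp (-(l ^ α / Real.cos (Real.pi * α / 2))) : ℝ) := by
  rw [stableLaplace, ← Complex.ofReal_cpow hl]
  push_cast
  rfl

lemma ofReal_mul_cpow {x : ℝ} (hx : 0 < x) {z : ℂ} (hz : z ≠ 0) (a : ℝ) :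
    ((x : ℂ) * z) ^ (a : ℂ) = ((x ^ a : ℝ) : ℂ) * z ^ (a : ℂ) := by
  have hx' : (x : ℂ) ≠ 0 := by exact_mod_cast hx.ne'
  rw [Complex.cpow_def_of_ne_zero (mul_ne_zero hx' hz), Complex.log_ofReal_mul hx hz,
    Complex.cpow_def_of_ne_zero hz, Real.rpow_def_of_pos hx, Complex.ofReal_exp,
    ← Complex.exp_add]
  push_cast
  ring_nf

/-- The skewness term comes from `(∓i)^α = cos(πα/2) ∓ i sin(πα/2)` divided by the cosine, which
identifies the boundary values with the prescribed characteristic function. -/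
lemma stableLaplace_mul_I {α : ℝ} (h0 : 0 < α) (h1 : α < 1) (t : ℝ) :
    stableLaplace α (((-t : ℝ) : ℂ) * Complex.I) = Complex.exp (-((|t| ^ α : ℝ) : ℂ) *
      (1 - Complex.I * ((Real.sign t * Real.tan (Real.pi * α / 2) : ℝ) : ℂ))) := by
  have hc := cos_half_pi_mul_pos h0 h1
  have hcc : Complex.cos (Real.pi * α / 2) ≠ 0 := by exact_mod_cast hc.ne'
  have hα : (α : ℂ) ≠ 0 := by exact_mod_cast h0.ne'
  rw [stableLaplace]
  congr 1
  rcases lt_trichotomy t 0 with ht | rfl | ht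
  · rw [ofReal_mul_cpow (by linarith) Complex.I_ne_zero, Real.sign_of_neg ht, abs_of_neg ht,
      Complex.cpow_def_of_ne_zero Complex.I_ne_zero, Complex.log_I,
      show (Real.pi / 2 * Complex.I * α : ℂ) = (Real.pi * α / 2) * Complex.I by ring,
      Complex.exp_mul_I]
    push_cast
    rw [Complex.tan_eq_sin_div_cos]
    field_simp
    ring
  · have : (α : ℝ) ≠ 0 := h0.ne'
    simp [hα, this]
  · rw [show ((-t : ℝ) : ℂ) * Complex.I = (t : ℂ) * -Complex.I by push_cast; ring,
      ofReal_mul_cpow ht (neg_ne_zero.2 Complex.I_ne_zero), Real.sign_of_pos ht, abs_of_pos ht,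
      Complex.cpow_def_of_ne_zero (neg_ne_zero.2 Complex.I_ne_zero), Complex.log_neg_I,
      show (-(Real.pi / 2) * Complex.I * α : ℂ) = (-(Real.pi * α / 2)) * Complex.I by ring,
      Complex.exp_mul_I, Complex.cos_neg, Complex.sin_neg]
    push_cast
    rw [Complex.tan_eq_sin_div_cos]
    field_simp
    ring

/-- If the Laplace transform of a law on `[0,∞)` extends to the closed right half-plane,
then the extension gives the characteristic function on the imaginary axis. -/
theorem charFun_eq_of_laplace {ν : Measure ℝ} [IsProbabilityMeasure ν] (hν : ∀ᵐ x ∂ν, 0 ≤ x)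
    {ψ : ℂ → ℂ} (hd : DifferentiableOn ℂ ψ {z | 0 < z.re}) (hc : ContinuousOn ψ {z | 0 ≤ z.re})
    (hL : ∀ l : ℝ, 0 < l → ((∫ x, Real.exp (-(l * x)) ∂ν : ℝ) : ℂ) = ψ l) (t : ℝ) :
    charFun ν t = ψ (((-t : ℝ) : ℂ) * Complex.I) := by
  set H : ℂ → ℂ := fun z => complexMGF id ν (-z) with hH
  have hopen : IsOpen {z : ℂ | 0 < z.re} := isOpen_lt continuous_const Complex.continuous_re
  have hset : Iio (0 : ℝ) ⊆ interior (integrableExpSet id ν) := by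
    refine interior_maximal (fun s hs => ?_) isOpen_Iio
    refine Integrable.mono' (integrable_const (1 : ℝ)) (by fun_prop) ?_
    filter_upwards [hν] with x hx
    rw [Real.norm_eq_abs, abs_of_pos (Real.exp_pos _), Real.exp_le_one_iff]
    exact mul_nonpos_of_nonpos_of_nonneg (le_of_lt hs) hx
  have hHd : DifferentiableOn ℂ H {z | 0 < z.re} := by
    refine (differentiableOn_complexMGF (X := id) (μ := ν)).comp (by fun_prop) fun z hz => ?_
    apply hset
    simpa using hz
  -- Identity theorem: the two holomorphic functions agree at real points accumulating at `1`. The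
  -- imaginary axis is then reached as a limit from the right.
  have heq : EqOn H ψ {z | 0 < z.re} := by
    refine AnalyticOnNhd.eqOn_of_preconnected_of_frequently_eq (hHd.analyticOnNhd hopen)
      (hd.analyticOnNhd hopen) (convex_halfSpace_re_gt 0).isPreconnected
      (z₀ := 1) (by simp) ?_
    have h1 : Tendsto (fun x : ℝ => (x : ℂ)) (𝓝[>] 1) (𝓝[≠] 1) := by
      refine tendsto_nhdsWithin_iff.2 ⟨?_, ?_⟩
      · have : Tendsto (fun x : ℝ => (x : ℂ)) (𝓝 1) (𝓝 ((1 : ℝ) : ℂ)) :=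
          Complex.continuous_ofReal.tendsto 1
        simpa using this.mono_left nhdsWithin_le_nhds
      · filter_upwards [self_mem_nhdsWithin] with x hx
        have : (x : ℂ) ≠ 1 := by exact_mod_cast (ne_of_gt hx)
        simpa using this
    refine h1.frequently (Eventually.frequently ?_)
    filter_upwards [self_mem_nhdsWithin] with x hx
    rw [← hL x (lt_trans one_pos hx), hH, ← integral_complex_ofReal]
    simp only [complexMGF]
    congr 1 with y
    push_cast
    simp
  have hlim1 : Tendsto (fun s : ℝ => H (s + ((-t : ℝ) : ℂ) * Complex.I)) (𝓝[>] 0)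
      (𝓝 (charFun ν t)) := by
    simp only [charFun_apply_real, hH, complexMGF]
    refine tendsto_integral_filter_of_dominated_convergence (fun _ => 1) ?_ ?_
      (integrable_const _) ?_
    · exact Eventually.of_forall fun s => by fun_prop
    · filter_upwards [self_mem_nhdsWithin] with s hs
      filter_upwards [hν] with x hx
      rw [Complex.norm_exp, Real.exp_le_one_iff]
      have : 0 ≤ s * x := mul_nonneg (le_of_lt hs) hx
      simpa using this
    · refine Eventually.of_forall fun x => ?_
      have : Continuous fun s : ℝ =>
          Complex.exp (-(s + ((-t : ℝ) : ℂ) * Complex.I) * (id x : ℝ)) := by fun_prop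
      have h2 := (this.tendsto 0).mono_left (nhdsWithin_le_nhds (s := Ioi 0))
      convert h2 using 3
      push_cast
      simp
      ring
  have hlim2 : Tendsto (fun s : ℝ => H (s + ((-t : ℝ) : ℂ) * Complex.I)) (𝓝[>] 0)
      (𝓝 (ψ (((-t : ℝ) : ℂ) * Complex.I))) := by
    have hw : ContinuousWithinAt ψ {z | 0 ≤ z.re} (((-t : ℝ) : ℂ) * Complex.I) :=
      hc _ (by rw [mem_ofPred_eq, Complex.re_ofReal_mul]; simp)
    have h3 : Tendsto (fun s : ℝ => ψ (s + ((-t : ℝ) : ℂ) * Complex.I)) (𝓝[>] 0)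
        (𝓝 (ψ (((-t : ℝ) : ℂ) * Complex.I))) := by
      refine hw.tendsto.comp (tendsto_nhdsWithin_iff.2 ⟨?_, ?_⟩)
      · have : Continuous fun s : ℝ => (s : ℂ) + ((-t : ℝ) : ℂ) * Complex.I := by fun_prop
        have h2 := (this.tendsto 0).mono_left (nhdsWithin_le_nhds (s := Ioi 0))
        simpa using h2
      · filter_upwards [self_mem_nhdsWithin] with s hs
        simpa using le_of_lt hs
    refine h3.congr' ?_
    filter_upwards [self_mem_nhdsWithin] with s hs
    refine (heq ?_).symm
    simpa using hs
  exact tendsto_nhds_unique hlim1 hlim2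

section Stable

variable {α : ℝ} {μ : Measure ℝ}

/-- Average the characteristic function over a Cauchy variable of scale `l`. By Fubini this is the
mean of `exp (-l|x|)`; by Poisson's formula it is the value of the extension at `l`. The absolute
value remains because the sign of `x` is not yet known. -/
theorem IsMaxSkewedStable.integral_exp_abs (h : IsMaxSkewedStable α μ) (h0 : 0 < α) (h1 : α < 1)
    {l : ℝ} (hl : 0 < l) :
    ((∫ x, Real.exp (-(l * |x|)) ∂μ : ℝ) : ℂ) = stableLaplace α l := by
  have := h.isProbabilityMeasure
  rw [← halfPlane_mean_value (differentiableOn_stableLaplace α) (continuousOn_stableLaplace h0)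
    (fun z hz => norm_stableLaplace_le_one h0 h1 hz) hl]
  have e1 : ∀ θ : ℝ, stableLaplace α (((-(l * Real.tan (θ / 2)) : ℝ) : ℂ) * Complex.I) =
      ∫ x, Complex.exp (((l * x * Real.tan (θ / 2) : ℝ) : ℂ) * Complex.I) ∂μ := fun θ => by
    rw [stableLaplace_mul_I h0 h1, ← h.charFun_eq, charFun_apply_real]
    congr 1 with x
    push_cast
    ring_nf
  simp only [e1]
  rw [intervalIntegral_integral_swap, ← integral_smul, ← integral_complex_ofReal]
  · congr 1 with x
    rw [integral_exp_tan_half, abs_mul, abs_of_pos hl]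
  · have hfin : IsFiniteMeasure ((volume : Measure ℝ).restrict (uIoc (-Real.pi) Real.pi)) :=
      isFiniteMeasure_restrict.2 (by simp [uIoc])
    refine Integrable.mono' (integrable_const (1 : ℝ)) ?_ ?_
    · have : Measurable Real.tan := by
        simp only [funext Real.tan_eq_sin_div_cos]
        fun_prop
      refine Measurable.aestronglyMeasurable ?_
      unfold Function.uncurry
      fun_prop
    · refine Eventually.of_forall fun p => ?_
      simp only [Function.uncurry]
      rw [Complex.norm_exp_ofReal_mul_I]

theorem IsMaxSkewedStable.ae_nonneg (h : IsMaxSkewedStable α μ) (h0 : 0 < α) (h1 : α < 1) :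
    ∀ᵐ x ∂μ, 0 ≤ x := by
  have := h.isProbabilityMeasure
  have hm : Measurable fun x : ℝ => |x| := continuous_abs.measurable
  have hprob : IsProbabilityMeasure (μ.map fun x => |x|) :=
    Measure.isProbabilityMeasure_map hm.aemeasurable
  have hnn : ∀ᵐ x ∂(μ.map fun x => |x|), 0 ≤ x := by
    rw [ae_map_iff hm.aemeasurable measurableSet_Ici]
    exact Eventually.of_forall fun x => abs_nonneg x
  -- The law of `|x|` lives on `[0,∞)`, so its Laplace transform determines its characteristic
  -- function, which turns out to be that of `μ`.
  have heq : μ.map (fun x => |x|) = μ := by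
    apply Measure.ext_of_charFun
    funext t
    rw [charFun_eq_of_laplace hnn (differentiableOn_stableLaplace α)
      (continuousOn_stableLaplace h0) _ t, stableLaplace_mul_I h0 h1, h.charFun_eq]
    intro l hl
    rw [integral_map hm.aemeasurable (by fun_prop), h.integral_exp_abs h0 h1 hl]
  rwa [heq] at hnn

theorem IsMaxSkewedStable.integral_exp (h : IsMaxSkewedStable α μ) (h0 : 0 < α) (h1 : α < 1)
    {l : ℝ} (hl : 0 < l) :
    ∫ x, Real.exp (-(l * x)) ∂μ = Real.exp (-(l ^ α / Real.cos (Real.pi * α / 2))) := by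
  have h2 := h.integral_exp_abs h0 h1 hl
  rw [stableLaplace_ofReal α hl.le, Complex.ofReal_inj] at h2
  rw [← h2]
  refine integral_congr_ae ?_
  filter_upwards [h.ae_nonneg h0 h1] with x hx
  rw [abs_of_nonneg hx]

/-- An atom at zero would bound the Laplace transform from below, but that transform tends to `0` as
`l → ∞`. -/
theorem IsMaxSkewedStable.ae_pos (h : IsMaxSkewedStable α μ) (h0 : 0 < α) (h1 : α < 1) :
    ∀ᵐ x ∂μ, 0 < x := by
  have := h.isProbabilityMeasure
  have hc := cos_half_pi_mul_pos h0 h1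
  have hle : ∀ l : ℝ, 0 < l → μ.real {0} ≤ Real.exp (-(l ^ α / Real.cos (Real.pi * α / 2))) := by
    intro l hl
    rw [← h.integral_exp h0 h1 hl, ← integral_indicator_one (measurableSet_singleton 0)]
    refine integral_mono_ae ?_ ?_ ?_
    · exact (integrable_const (1 : ℝ)).indicator (measurableSet_singleton 0)
    · refine Integrable.mono' (integrable_const (1 : ℝ)) (by fun_prop) ?_
      filter_upwards [h.ae_nonneg h0 h1] with x hx
      rw [Real.norm_eq_abs, abs_of_pos (Real.exp_pos _), Real.exp_le_one_iff]
      nlinarith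
    · refine Eventually.of_forall fun x => ?_
      by_cases hx : x = 0
      · simp [hx]
      · simp [hx, Real.exp_nonneg]
  have hlim : Tendsto (fun l : ℝ => Real.exp (-(l ^ α / Real.cos (Real.pi * α / 2)))) atTop
      (𝓝 0) :=
    Real.tendsto_exp_neg_atTop_nhds_zero.comp ((tendsto_rpow_atTop h0).atTop_div_const hc)
  have hz : μ.real {0} ≤ 0 := by
    refine ge_of_tendsto hlim ?_
    filter_upwards [eventually_gt_atTop 0] with l hl using hle l hl
  have hz' : μ {0} = 0 := by
    have : μ.real {0} = 0 := le_antisymm hz measureReal_nonneg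
    rwa [measureReal_eq_zero_iff] at this
  have hne : ∀ᵐ x ∂μ, x ≠ 0 := by simpa [ae_iff] using hz'
  filter_upwards [h.ae_nonneg h0 h1, hne] with x hx hx' using lt_of_le_of_ne hx hx'.symm

end Stable

/-! ### The case `α = 1/2` -/

/-- The Cauchy–Schlömilch transformation of the Gaussian integral. -/
theorem integral_Ioi_gaussian_sub_div {a : ℝ} (ha : 0 < a) :
    ∫ z in Ioi (0 : ℝ), Real.exp (-(1 / 2) * (z - a / z) ^ 2) = √(2 * Real.pi) / 2 := by
  set g : ℝ → ℝ := fun u => Real.exp (-(1 / 2) * u ^ 2) with hg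
  set f : ℝ → ℝ := fun z => z - a / z with hf
  have hgi : Integrable g := integrable_exp_neg_mul_sq (by norm_num)
  have hgI : ∫ u, g u = √(2 * Real.pi) := by
    rw [hg, integral_gaussian]; congr 1; ring
  have hf' : ∀ z ∈ Ioi (0 : ℝ), HasDerivWithinAt f (1 + a / z ^ 2) (Ioi 0) z := by
    intro z hz
    have hz0 : z ≠ 0 := ne_of_gt hz
    have := (hasDerivAt_id z).sub ((hasDerivAt_inv hz0).const_mul a)
    refine (this.congr_deriv ?_).hasDerivWithinAt
    field_simp
    ring
  have hinj : InjOn f (Ioi 0) := by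
    intro x hx y hy hxy
    have hx : 0 < x := hx
    have hy : 0 < y := hy
    simp only [hf] at hxy
    field_simp at hxy
    have : (x - y) * (x * y + a) = 0 := by linear_combination hxy
    rcases mul_eq_zero.1 this with h | h
    · linarith
    · nlinarith [mul_pos hx hy]
  have himg : f '' Ioi 0 = univ := by
    refine eq_univ_of_forall fun u => ?_
    have h4 : u < √(u ^ 2 + 4 * a) ∧ -u < √(u ^ 2 + 4 * a) := by
      constructor <;> exact Real.lt_sqrt_of_sq_lt (by nlinarith)
    have hs := Real.sq_sqrt (show 0 ≤ u ^ 2 + 4 * a by positivity)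
    -- The positive root of `z² - uz - a = 0`, which is the equation `z - a/z = u`.
    have hz : 0 < (u + √(u ^ 2 + 4 * a)) / 2 := by linarith [h4.2]
    refine ⟨(u + √(u ^ 2 + 4 * a)) / 2, hz, ?_⟩
    have hz' : u + √(u ^ 2 + 4 * a) ≠ 0 := by linarith
    simp only [hf]
    field_simp
    nlinarith
  have hI := integrableOn_image_iff_integrableOn_abs_deriv_smul measurableSet_Ioi hf' hinj g
  have hE := integral_image_eq_integral_abs_deriv_smul measurableSet_Ioi hf' hinj g
  rw [himg] at hI hE
  have hI' := hI.1 hgi.integrableOn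
  rw [setIntegral_univ, hgI] at hE
  have habs : ∀ z ∈ Ioi (0 : ℝ), |1 + a / z ^ 2| • g (f z) = g (f z) + a / z ^ 2 * g (f z) := by
    intro z _
    rw [abs_of_pos (by positivity), smul_eq_mul]
    ring
  rw [setIntegral_congr_fun measurableSet_Ioi habs] at hE
  rw [integrableOn_congr_fun habs measurableSet_Ioi] at hI'
  have hgpos : ∀ u, 0 < g u := fun u => Real.exp_pos _
  have hmeas : Measurable fun z => g (f z) := by simp only [hg, hf]; fun_prop
  have hI1 : IntegrableOn (fun z => g (f z)) (Ioi 0) := by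
    refine Integrable.mono' hI' hmeas.aestronglyMeasurable ?_
    refine Eventually.of_forall fun z => ?_
    rw [Real.norm_eq_abs, abs_of_pos (hgpos _)]
    have := hgpos (f z)
    have : 0 ≤ a / z ^ 2 * g (f z) := by positivity
    linarith
  have hI2 : IntegrableOn (fun z => a / z ^ 2 * g (f z)) (Ioi 0) := by
    have := hI'.sub hI1
    refine this.congr (Eventually.of_forall fun z => ?_)
    simp
  rw [integral_add hI1 hI2] at hE
  have hh' : ∀ z ∈ Ioi (0 : ℝ), HasDerivWithinAt (fun z => a / z) (-(a / z ^ 2)) (Ioi 0) z := by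
    intro z hz
    have hz0 : z ≠ 0 := ne_of_gt hz
    have := (hasDerivAt_inv hz0).const_mul a
    refine (this.congr_deriv ?_).hasDerivWithinAt
    field_simp
  have hhinj : InjOn (fun z => a / z) (Ioi 0) := by
    intro x hx y hy hxy
    have hx : 0 < x := hx
    have hy : 0 < y := hy
    simp only at hxy
    field_simp at hxy
    exact hxy.symm
  have hhimg : (fun z => a / z) '' Ioi 0 = Ioi 0 := by
    ext u
    constructor
    · rintro ⟨z, hz, rfl⟩
      exact div_pos ha hz
    · intro hu
      have hu : 0 < u := hu
      exact ⟨a / u, div_pos ha hu, by field_simp⟩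
  -- The substitution `z ↦ a/z` changes the sign of `z - a/z`, and `g` is even, so the two summands
  -- in `hE` are equal and each is half the Gaussian integral.
  have hE2 := integral_image_eq_integral_abs_deriv_smul measurableSet_Ioi hh' hhinj
    (fun z => g (f z))
  rw [hhimg] at hE2
  have hE3 : ∫ z in Ioi 0, |-(a / z ^ 2)| • g (f (a / z)) =
      ∫ z in Ioi 0, a / z ^ 2 * g (f z) := by
    refine setIntegral_congr_fun measurableSet_Ioi fun z hz => ?_
    have hz : 0 < z := hz
    have h5 : f (a / z) = -f z := by simp only [hf]; field_simp; ring
    have h6 : g (-f z) = g (f z) := by simp only [hg, neg_sq]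
    simp only [h5, h6, abs_neg, smul_eq_mul]
    rw [abs_of_pos (by positivity)]
  rw [hE3] at hE2
  rw [← hE2] at hE
  have : ∫ z in Ioi 0, g (f z) = √(2 * Real.pi) / 2 := by linarith
  exact this

/-- Complete the square: with `a = √(2l)`, `z²/2 + l/z² = (z - a/z)²/2 + a`. -/
theorem integral_exp_neg_div_sq_gaussian {l : ℝ} (hl : 0 ≤ l) :
    ∫ z, Real.exp (-(l / z ^ 2)) ∂(gaussianReal 0 1) = Real.exp (-√(2 * l)) := by
  rcases hl.eq_or_lt with rfl | hl
  · simp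
  set a := √(2 * l) with ha
  have hapos : 0 < a := Real.sqrt_pos.2 (by positivity)
  have ha2 : a ^ 2 = 2 * l := Real.sq_sqrt (by positivity)
  rw [integral_gaussianReal_eq_integral_smul (by simp)]
  have h1 : ∀ z : ℝ, gaussianPDFReal 0 1 z • Real.exp (-(l / z ^ 2)) =
      (fun z => (√(2 * Real.pi))⁻¹ * Real.exp (-(1 / 2) * z ^ 2) * Real.exp (-(l / z ^ 2))) |z| := by
    intro z
    simp [gaussianPDFReal]
    left
    ring
  simp only [h1]
  rw [integral_comp_abs
    (f := fun z => (√(2 * Real.pi))⁻¹ * Real.exp (-(1 / 2) * z ^ 2) * Real.exp (-(l / z ^ 2)))]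
  have h2 : ∀ z ∈ Ioi (0 : ℝ),
      (√(2 * Real.pi))⁻¹ * Real.exp (-(1 / 2) * z ^ 2) * Real.exp (-(l / z ^ 2)) =
        ((√(2 * Real.pi))⁻¹ * Real.exp (-a)) * Real.exp (-(1 / 2) * (z - a / z) ^ 2) := by
    intro z hz
    have hz : 0 < z := hz
    rw [mul_assoc, mul_assoc, ← Real.exp_add, ← Real.exp_add]
    congr 2
    have : (z - a / z) ^ 2 = z ^ 2 - 2 * a + a ^ 2 / z ^ 2 := by field_simp; ring
    rw [this, ha2]
    ring
  rw [setIntegral_congr_fun measurableSet_Ioi h2, integral_const_mul,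
    integral_Ioi_gaussian_sub_div hapos]
  have : √(2 * Real.pi) ≠ 0 := (Real.sqrt_pos.2 (by positivity)).ne'
  field_simp

/-- The Lévy law: its Laplace transform `exp (-√(2l))` is `exp (-(√l / cos(π/4)))`, so the
characteristic function follows by analytic continuation. -/
theorem isMaxSkewedStable_half :
    IsMaxSkewedStable (1 / 2) ((gaussianReal 0 1).map fun z => 1 / z ^ 2) := by
  have hm : Measurable fun z : ℝ => 1 / z ^ 2 := by fun_prop
  have hp : IsProbabilityMeasure ((gaussianReal 0 1).map fun z => 1 / z ^ 2) :=
    Measure.isProbabilityMeasure_map hm.aemeasurable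
  refine ⟨hp, fun t => ?_⟩
  rw [← stableLaplace_mul_I (by norm_num) (by norm_num) t]
  refine charFun_eq_of_laplace ?_ (differentiableOn_stableLaplace _)
    (continuousOn_stableLaplace (by norm_num)) ?_ t
  · rw [ae_map_iff hm.aemeasurable measurableSet_Ici]
    exact Eventually.of_forall fun x => by positivity
  · intro l hl
    rw [integral_map hm.aemeasurable (by fun_prop), stableLaplace_ofReal _ hl.le]
    have h4 : Real.pi * (1 / 2) / 2 = Real.pi / 4 := by ring
    rw [h4]
    simp only [mul_one_div]
    rw [integral_exp_neg_div_sq_gaussian hl.le, ← Real.sqrt_eq_rpow, Real.cos_pi_div_four,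
      mul_comm, Real.sqrt_mul hl.le]
    congr 3
    have : √(2 : ℝ) * √2 = 2 := Real.mul_self_sqrt (by norm_num)
    field_simp
    linarith

/-- The quotient of two independent standard normal variables is Cauchy distributed. -/
theorem map_div_gaussian_prod :
    ((gaussianReal 0 1).prod (gaussianReal 0 1)).map (fun p : ℝ × ℝ => p.1 / p.2) =
      (ENNReal.ofReal (2 * Real.pi)⁻¹ • volume.restrict (Ioc (-Real.pi) Real.pi)).map
        (fun θ => Real.tan (θ / 2)) := by
  have hmt : Measurable fun θ => Real.tan (θ / 2) := by
    simp only [Real.tan_eq_sin_div_cos]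
    fun_prop
  have hmd : Measurable (fun p : ℝ × ℝ => p.1 / p.2) := by fun_prop
  have hfin : IsFiniteMeasure
      (ENNReal.ofReal (2 * Real.pi)⁻¹ • volume.restrict (Ioc (-Real.pi) Real.pi)) :=
    Measure.smul_finite _ ENNReal.ofReal_ne_top
  apply Measure.ext_of_charFun
  funext u
  rw [charFun_apply_real, charFun_apply_real, integral_map hmd.aemeasurable (by fun_prop),
    integral_map hmt.aemeasurable (by fun_prop), integral_smul_measure,
    ENNReal.toReal_ofReal (by positivity),
    ← intervalIntegral.integral_of_le (by linarith [Real.pi_pos])]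
  have h1 := integral_exp_tan_half u
  push_cast at h1 ⊢
  rw [h1]
  have hint : Integrable (fun p : ℝ × ℝ => Complex.exp (u * (p.1 / p.2) * Complex.I))
      ((gaussianReal 0 1).prod (gaussianReal 0 1)) := by
    refine Integrable.mono' (integrable_const (1 : ℝ))
      (Measurable.aestronglyMeasurable (by fun_prop)) ?_
    refine Eventually.of_forall fun p => ?_
    rw [← Complex.ofReal_div, ← Complex.ofReal_mul, Complex.norm_exp_ofReal_mul_I]
  -- Integrating the numerator first gives a Gaussian characteristic function at `u / y`. The
  -- formula also holds at `y = 0`, where division by zero makes both sides `1`.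
  rw [integral_prod_symm _ hint]
  have h2 : ∀ y : ℝ, ∫ x, Complex.exp (u * (x / y) * Complex.I) ∂(gaussianReal 0 1) =
      ((Real.exp (-((u ^ 2 / 2) / y ^ 2)) : ℝ) : ℂ) := by
    intro y
    have := charFun_gaussianReal (μ := 0) (v := 1) (u / y)
    rw [charFun_apply_real] at this
    push_cast at this ⊢
    simp only [mul_zero, zero_mul, zero_sub] at this
    convert this using 2
    · ext x; ring_nf
    · simp; ring
  simp only [h2]
  rw [integral_complex_ofReal, integral_exp_neg_div_sq_gaussian (by positivity)]
  rw [show 2 * (u ^ 2 / 2) = u ^ 2 by ring, Real.sqrt_sq_eq_abs]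
  push_cast
  rfl

lemma mul_abs_tan_le_iff {b c φ : ℝ} (hb : 0 ≤ b) (hc : 0 < c)
    (hφ : φ ∈ Ioo (-(Real.pi / 2)) (Real.pi / 2)) :
    b * |Real.tan φ| ≤ c ↔ |φ| ≤ Real.pi / 2 - Real.arctan (b / c) := by
  have habs : |φ| < Real.pi / 2 := abs_lt.2 hφ
  rcases hb.eq_or_lt with rfl | hb
  · simp [hc.le, habs.le]
  · have h1 : |Real.tan φ| = Real.tan |φ| := by
      rcases le_total 0 φ with h | h
      · rw [abs_of_nonneg h, abs_of_nonneg (Real.tan_nonneg_of_nonneg_of_le_pi_div_two h hφ.2.le)]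
      · rw [abs_of_nonpos h, Real.tan_neg, abs_of_nonpos
          (Real.tan_nonpos_of_nonpos_of_neg_pi_div_two_le h hφ.1.le)]
    have h2 : Real.arctan (Real.tan |φ|) = |φ| :=
      Real.arctan_tan (by linarith [abs_nonneg φ, Real.pi_pos]) habs
    rw [h1, ← Real.arctan_inv_of_pos (div_pos hb hc), inv_div, ← h2,
      Real.arctan_strictMono.le_iff_le, h2, le_div_iff₀ hb, mul_comm]

/-- With `Sᵢ = 1/Zᵢ²` the event reads `b |Z₁/Z₂| ≤ √ε`, and the Cauchy variable `Z₁/Z₂` has the law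
of the tangent of a uniform angle; the event becomes an interval of angles. -/
theorem stableLaw_half_ratio {b ε : ℝ} (hb : 0 ≤ b) (hε : 0 < ε) :
    ((stableLaw (1 / 2)).prod (stableLaw (1 / 2))).real {p | b ^ 2 * (p.2 / p.1) ≤ ε} =
      1 - 2 / Real.pi * Real.arctan (b / √ε) := by
  have hm : Measurable fun z : ℝ => 1 / z ^ 2 := by fun_prop
  have hmt : Measurable fun θ => Real.tan (θ / 2) := by
    simp only [Real.tan_eq_sin_div_cos]
    fun_prop
  have hmd : Measurable (fun p : ℝ × ℝ => p.1 / p.2) := by fun_prop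
  have hsε : 0 < √ε := Real.sqrt_pos.2 hε
  rw [← isMaxSkewedStable_half.eq_stableLaw, Measure.map_prod_map _ _ hm hm,
    measureReal_def, Measure.map_apply (by fun_prop) (measurableSet_le (by fun_prop) (by fun_prop))]
  have hset : Prod.map (fun z : ℝ => 1 / z ^ 2) (fun z : ℝ => 1 / z ^ 2) ⁻¹'
      {p | b ^ 2 * (p.2 / p.1) ≤ ε} =
      (fun p : ℝ × ℝ => p.1 / p.2) ⁻¹' {x | b * |x| ≤ √ε} := by
    ext p
    simp only [mem_preimage, mem_ofPred_eq, Prod.map]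
    rw [Real.le_sqrt (by positivity) hε.le, mul_pow, sq_abs, div_pow]
    have : 1 / p.2 ^ 2 / (1 / p.1 ^ 2) = p.1 ^ 2 / p.2 ^ 2 := by
      rw [one_div, one_div, div_inv_eq_mul, mul_comm, div_eq_mul_inv]
    rw [this]
  rw [hset, ← Measure.map_apply hmd (measurableSet_le (by fun_prop) (by fun_prop)),
    map_div_gaussian_prod, Measure.map_apply hmt (measurableSet_le (by fun_prop) (by fun_prop)),
    Measure.smul_apply, smul_eq_mul, ENNReal.toReal_mul, ENNReal.toReal_ofReal (by positivity)]
  set A := Real.pi / 2 - Real.arctan (b / √ε) with hA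
  have hA0 : 0 ≤ A := by linarith [Real.arctan_lt_pi_div_two (b / √ε)]
  have hA1 : A ≤ Real.pi / 2 := by
    have : 0 ≤ Real.arctan (b / √ε) := Real.arctan_nonneg.2 (by positivity)
    linarith
  have hvol : (volume.restrict (Ioc (-Real.pi) Real.pi))
      ((fun θ => Real.tan (θ / 2)) ⁻¹' {x | b * |x| ≤ √ε}) =
      volume (Icc (-(2 * A)) (2 * A)) := by
    rw [Measure.restrict_apply' measurableSet_Ioc]
    refine measure_congr (Filter.eventuallyEq_set.2 ?_)
    have h1 : ∀ᵐ θ : ℝ, θ ≠ Real.pi := by simp [ae_iff]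
    have h2 : ∀ᵐ θ : ℝ, θ ≠ -Real.pi := by simp [ae_iff]
    filter_upwards [h1, h2] with θ h1 h2
    simp only [mem_inter_iff, mem_preimage, mem_ofPred_eq]
    constructor
    · rintro ⟨h, h3⟩
      rw [mul_abs_tan_le_iff hb hsε ⟨by linarith [h3.1],
        by linarith [lt_of_le_of_ne h3.2 h1]⟩, abs_le] at h
      constructor <;> linarith [h.1, h.2]
    · intro h3
      have h4 : -Real.pi < θ := lt_of_le_of_ne (by linarith [h3.1]) h2.symm
      have h5 : θ < Real.pi := lt_of_le_of_ne (by linarith [h3.2]) h1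
      refine ⟨?_, h4, h5.le⟩
      rw [mul_abs_tan_le_iff hb hsε ⟨by linarith, by linarith⟩, abs_le]
      constructor <;> linarith [h3.1, h3.2]
  rw [hvol, Real.volume_Icc, ENNReal.toReal_ofReal (by linarith), hA]
  have := Real.pi_ne_zero
  field_simp
  ring

/-! ### The limit `α → 0+` -/

lemma tendsto_rpow_inv_of_lt_one {q : ℝ} (h0 : 0 < q) (h1 : q < 1) :
    Tendsto (fun α : ℝ => q ^ (1 / α)) (𝓝[>] 0) (𝓝 0) := by
  have h := tendsto_rpow_atTop_of_base_lt_one q (by linarith) h1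
  simpa only [one_div, Function.comp_def] using h.comp tendsto_inv_nhdsGT_zero

lemma tendsto_rpow_inv_of_one_lt {q : ℝ} (h1 : 1 < q) :
    Tendsto (fun α : ℝ => q ^ (1 / α)) (𝓝[>] 0) atTop := by
  have h := tendsto_rpow_atTop_of_base_gt_one q h1
  simpa only [one_div, Function.comp_def] using h.comp tendsto_inv_nhdsGT_zero

lemma rpow_inv_mul_eq {v y α : ℝ} (hv : 0 < v) (hy : 0 < y) (hα : 0 < α) :
    v ^ (1 / α) * y = (v * y ^ α) ^ (1 / α) := by
  rw [Real.mul_rpow hv.le (by positivity), ← Real.rpow_mul hy.le, mul_one_div_cancel hα.ne',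
    Real.rpow_one]

lemma integrable_exp_neg_mul {ν : Measure ℝ} [IsFiniteMeasure ν] (hν : ∀ᵐ y ∂ν, 0 < y)
    {c : ℝ} (hc : 0 ≤ c) : Integrable (fun y => Real.exp (-(c * y))) ν := by
  refine Integrable.mono' (integrable_const (1 : ℝ)) (by fun_prop) ?_
  filter_upwards [hν] with y hy
  rw [Real.norm_eq_abs, abs_of_pos (Real.exp_pos _), Real.exp_le_one_iff]
  have := mul_nonneg hc hy.le
  linarith

/-- As `α → 0+`, the function `y ↦ exp (-(v^(1/α) y))` approaches the indicator of
`v y^α < 1`, so that Laplace transforms determine the limit of the distribution of `y^α`. -/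
theorem tendsto_measureReal_of_laplace {ν : ℝ → Measure ℝ} {h : ℝ → ℝ} {u : ℝ} {w : ℝ → ℝ}
    (hu : 0 < u)
    (hν : ∀ᶠ α in 𝓝[>] 0, IsProbabilityMeasure (ν α) ∧ ∀ᵐ y ∂(ν α), 0 < y)
    (hL : ∀ v, 0 < v → Tendsto (fun α => ∫ y, Real.exp (-(v ^ (1 / α) * y)) ∂(ν α))
      (𝓝[>] 0) (𝓝 (h v)))
    (hc : ContinuousAt h u) (hw : Tendsto w (𝓝[>] 0) (𝓝 u)) :
    Tendsto (fun α => (ν α).real {y | w α * y ^ α ≤ 1}) (𝓝[>] 0) (𝓝 (h u)) := by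
  have hmeas : ∀ α : ℝ, MeasurableSet {y : ℝ | w α * y ^ α ≤ 1} := fun α =>
    measurableSet_le (by fun_prop) (by fun_prop)
  refine tendsto_order.2 ⟨fun a ha => ?_, fun a ha => ?_⟩
  · obtain ⟨v, huv, hv⟩ : ∃ v, u < v ∧ a < h v := by
      have h1 : ∀ᶠ v in 𝓝[>] u, a < h v :=
        (hc.eventually (lt_mem_nhds ha)).filter_mono nhdsWithin_le_nhds
      obtain ⟨v, h2, h3⟩ := (h1.and self_mem_nhdsWithin).exists
      exact ⟨v, h3, h2⟩
    have hv0 : 0 < v := hu.trans huv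
    -- The margin `q > 1`: once `w α < v / q`, every `y` outside the event has `v y^α > q`, so the
    -- exponential there is at most `exp (-q^(1/α))`, which vanishes in the limit.
    obtain ⟨q, hq1, hqv⟩ := exists_between ((one_lt_div hu).2 huv)
    have hq0 : 0 < q := one_pos.trans hq1
    have hwq : ∀ᶠ α in 𝓝[>] 0, w α < v / q :=
      hw.eventually (gt_mem_nhds (by rw [lt_div_iff₀ hu] at hqv; rw [lt_div_iff₀ hq0]; linarith))
    have hlim : Tendsto (fun α => ∫ y, Real.exp (-(v ^ (1 / α) * y)) ∂(ν α) -
        Real.exp (-(q ^ (1 / α)))) (𝓝[>] 0) (𝓝 (h v - 0)) :=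
      (hL v hv0).sub
        (Real.tendsto_exp_neg_atTop_nhds_zero.comp (tendsto_rpow_inv_of_one_lt hq1))
    rw [sub_zero] at hlim
    filter_upwards [hν, hwq, hlim.eventually (lt_mem_nhds hv), self_mem_nhdsWithin]
      with α ⟨hp, hpos⟩ hwα hlt hα
    have hα : 0 < α := hα
    refine hlt.trans_le ?_
    rw [sub_le_iff_le_add]
    have hind : Integrable ({y | w α * y ^ α ≤ 1}.indicator (1 : ℝ → ℝ)) (ν α) :=
      (integrable_const (1 : ℝ)).indicator (hmeas α)
    have h3 : (ν α).real {y | w α * y ^ α ≤ 1} + Real.exp (-(q ^ (1 / α))) =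
        ∫ y, ({y | w α * y ^ α ≤ 1}.indicator (1 : ℝ → ℝ) y + Real.exp (-(q ^ (1 / α)))) ∂(ν α) := by
      rw [integral_add hind (integrable_const _), integral_indicator_one (hmeas α)]
      simp
    rw [h3]
    refine integral_mono_ae (integrable_exp_neg_mul hpos (by positivity))
      (hind.add (integrable_const _)) ?_
    filter_upwards [hpos] with y hy
    have hyα : 0 < y ^ α := by positivity
    by_cases hmem : w α * y ^ α ≤ 1
    · rw [indicator_of_mem (by exact hmem), Pi.one_apply]
      have h4 : Real.exp (-(v ^ (1 / α) * y)) ≤ 1 :=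
        Real.exp_le_one_iff.2 (by have : 0 ≤ v ^ (1 / α) * y := by positivity
                                  linarith)
      have := Real.exp_pos (-(q ^ (1 / α)))
      linarith
    · rw [indicator_of_notMem (by exact hmem), zero_add, rpow_inv_mul_eq hv0 hy hα]
      refine Real.exp_le_exp.2 (neg_le_neg ?_)
      refine Real.rpow_le_rpow hq0.le ?_ (by positivity)
      push Not at hmem
      rw [lt_div_iff₀ hq0] at hwα
      have := mul_le_mul_of_nonneg_right hwα.le hyα.le
      nlinarith
  · obtain ⟨v, huv, hv0, hv⟩ : ∃ v, v < u ∧ 0 < v ∧ h v < a := by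
      have h1 : ∀ᶠ v in 𝓝[<] u, h v < a ∧ 0 < v :=
        ((hc.eventually (gt_mem_nhds ha)).and (lt_mem_nhds hu)).filter_mono nhdsWithin_le_nhds
      obtain ⟨v, h2, h3⟩ := (h1.and self_mem_nhdsWithin).exists
      exact ⟨v, h3, h2.2, h2.1⟩
    -- Now `q < 1`: on the event `v y^α ≤ q`, so the indicator is at most `exp (q^(1/α))` times the
    -- exponential, and this factor tends to `1`.
    obtain ⟨q, hqv, hq1⟩ := exists_between ((div_lt_one hu).2 huv)
    have hq0 : 0 < q := lt_trans (by positivity) hqv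
    have hwq : ∀ᶠ α in 𝓝[>] 0, v / q < w α :=
      hw.eventually (lt_mem_nhds (by rw [div_lt_iff₀ hu] at hqv; rw [div_lt_iff₀ hq0]; linarith))
    have hlim : Tendsto (fun α => Real.exp (q ^ (1 / α)) *
        ∫ y, Real.exp (-(v ^ (1 / α) * y)) ∂(ν α)) (𝓝[>] 0) (𝓝 (Real.exp 0 * h v)) :=
      (Real.continuous_exp.continuousAt.tendsto.comp (tendsto_rpow_inv_of_lt_one hq0 hq1)).mul
        (hL v hv0)
    rw [Real.exp_zero, one_mul] at hlim
    filter_upwards [hν, hwq, hlim.eventually (gt_mem_nhds hv), self_mem_nhdsWithin]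
      with α ⟨hp, hpos⟩ hwα hlt hα
    have hα : 0 < α := hα
    refine lt_of_le_of_lt ?_ hlt
    rw [← integral_indicator_one (hmeas α), ← integral_const_mul]
    refine integral_mono_ae ((integrable_const (1 : ℝ)).indicator (hmeas α))
      ((integrable_exp_neg_mul hpos (by positivity)).const_mul _) ?_
    filter_upwards [hpos] with y hy
    have hyα : 0 < y ^ α := by positivity
    by_cases hmem : w α * y ^ α ≤ 1
    · rw [indicator_of_mem (by exact hmem), Pi.one_apply, ← Real.exp_add, Real.one_le_exp_iff,
        rpow_inv_mul_eq hv0 hy hα, ← sub_eq_add_neg, sub_nonneg]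
      refine Real.rpow_le_rpow (by positivity) ?_ (by positivity)
      rw [div_lt_iff₀ hq0] at hwα
      have := mul_le_mul_of_nonneg_right hwα.le hyα.le
      nlinarith
    · rw [indicator_of_notMem (by exact hmem)]
      positivity

lemma tendsto_cos_half_pi_mul :
    Tendsto (fun α : ℝ => Real.cos (Real.pi * α / 2)) (𝓝[>] 0) (𝓝 1) := by
  have : Continuous fun α : ℝ => Real.cos (Real.pi * α / 2) := by fun_prop
  have h := (this.tendsto 0).mono_left (nhdsWithin_le_nhds (s := Ioi 0))
  simpa using h

lemma eventually_mem_Ioo_zero_one : ∀ᶠ α : ℝ in 𝓝[>] 0, 0 < α ∧ α < 1 :=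
  Ioo_mem_nhdsGT one_pos

section Limit

variable (hst : ∀ α, 0 < α → α < 1 → IsMaxSkewedStable α (stableLaw α))
include hst

/-- `S(α,1,1)^(-α)` converges in law to the standard exponential distribution. -/
theorem tendsto_stableLaw_rpow {u : ℝ} (hu : 0 < u) {w : ℝ → ℝ} (hw : Tendsto w (𝓝[>] 0) (𝓝 u)) :
    Tendsto (fun α => (stableLaw α).real {y | w α * y ^ α ≤ 1}) (𝓝[>] 0)
      (𝓝 (Real.exp (-u))) := by
  refine tendsto_measureReal_of_laplace (h := fun v => Real.exp (-v)) hu ?_ (fun v hv => ?_)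
    (by fun_prop) hw
  · filter_upwards [eventually_mem_Ioo_zero_one] with α hα
    exact ⟨(hst α hα.1 hα.2).isProbabilityMeasure, (hst α hα.1 hα.2).ae_pos hα.1 hα.2⟩
  · have h1 : Tendsto (fun α : ℝ => Real.exp (-(v / Real.cos (Real.pi * α / 2)))) (𝓝[>] 0)
        (𝓝 (Real.exp (-(v / 1)))) :=
      (Real.continuous_exp.tendsto _).comp
        ((tendsto_const_nhds.div tendsto_cos_half_pi_mul one_ne_zero).neg)
    rw [div_one] at h1
    refine h1.congr' ?_
    filter_upwards [eventually_mem_Ioo_zero_one] with α hα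
    rw [(hst α hα.1 hα.2).integral_exp hα.1 hα.2 (by positivity), ← Real.rpow_mul hv.le,
      one_div_mul_cancel hα.1.ne', Real.rpow_one]

/-- The limit is the Laplace transform of a standard exponential variable. The layer-cake formula
reduces it to convergence of level-set probabilities. -/
theorem tendsto_integral_exp_stableLaw_rpow {v : ℝ} (hv : 0 < v) :
    Tendsto (fun α => ∫ y, Real.exp (-(v / Real.cos (Real.pi * α / 2) / y ^ α)) ∂(stableLaw α))
      (𝓝[>] 0) (𝓝 (1 / (1 + v))) := by
  set F : ℝ → ℝ → ℝ := fun α t =>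
    (stableLaw α).real {y | t < Real.exp (-(v / Real.cos (Real.pi * α / 2) / y ^ α))} with hF
  have hlayer : ∀ᶠ α in 𝓝[>] 0, ∫ t in (0 : ℝ)..1, F α t =
      ∫ y, Real.exp (-(v / Real.cos (Real.pi * α / 2) / y ^ α)) ∂(stableLaw α) := by
    filter_upwards [eventually_mem_Ioo_zero_one] with α hα
    have hS := hst α hα.1 hα.2
    have hp := hS.isProbabilityMeasure
    have hcos := cos_half_pi_mul_pos hα.1 hα.2
    have hle : ∀ᵐ y ∂(stableLaw α),
        Real.exp (-(v / Real.cos (Real.pi * α / 2) / y ^ α)) ≤ 1 := by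
      filter_upwards [hS.ae_pos hα.1 hα.2] with y hy
      rw [Real.exp_le_one_iff, neg_nonpos]
      positivity
    have hint : Integrable (fun y => Real.exp (-(v / Real.cos (Real.pi * α / 2) / y ^ α)))
        (stableLaw α) := by
      refine Integrable.mono' (integrable_const (1 : ℝ))
        (Measurable.aestronglyMeasurable (by fun_prop)) ?_
      filter_upwards [hle] with y hy
      rwa [Real.norm_eq_abs, abs_of_pos (Real.exp_pos _)]
    rw [hint.integral_eq_integral_meas_lt (Eventually.of_forall fun y => (Real.exp_pos _).le),
      intervalIntegral.integral_of_le zero_le_one]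
    symm
    -- Levels above `1` contribute nothing, since the integrand is almost surely at most `1`.
    refine setIntegral_eq_of_subset_of_forall_sdiff_eq_zero measurableSet_Ioi Ioc_subset_Ioi_self
      fun t ht => ?_
    have ht1 : 1 < t := not_le.1 fun h => ht.2 ⟨ht.1, h⟩
    rw [measureReal_eq_zero_iff, measure_eq_zero_iff_ae_notMem]
    filter_upwards [hle] with y hy
    exact not_lt.2 (hy.trans ht1.le)
  have hlim : Tendsto (fun α => ∫ t in (0 : ℝ)..1, F α t) (𝓝[>] 0)
      (𝓝 (∫ t in (0 : ℝ)..1, (1 - t ^ (1 / v)))) := by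
    refine intervalIntegral.tendsto_integral_filter_of_dominated_convergence (fun _ => 1) ?_ ?_
      intervalIntegrable_const ?_
    · filter_upwards [eventually_mem_Ioo_zero_one] with α hα
      have hp := (hst α hα.1 hα.2).isProbabilityMeasure
      refine (Antitone.measurable fun s t hst => ?_).aestronglyMeasurable
      exact measureReal_mono fun y hy => lt_of_le_of_lt hst hy
    · filter_upwards [eventually_mem_Ioo_zero_one] with α hα
      have hp := (hst α hα.1 hα.2).isProbabilityMeasure
      refine Eventually.of_forall fun t _ => ?_
      rw [Real.norm_eq_abs, abs_of_nonneg measureReal_nonneg]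
      exact measureReal_le_one
    · have hne : ∀ᵐ t : ℝ, t ≠ 1 := by simp [ae_iff]
      filter_upwards [hne] with t ht1 ht
      rw [uIoc_of_le zero_le_one] at ht
      have ht0 : 0 < t := ht.1
      have hlog : 0 < -Real.log t := by
        have := Real.log_neg ht0 (lt_of_le_of_ne ht.2 ht1)
        linarith
      -- Solving `t < exp (-A / y^α)` with `A = v / cos(πα/2)` gives `1 < (-log t / A) y^α`, the
      -- complement of the event in `tendsto_stableLaw_rpow`.
      have hw : Tendsto (fun α => -Real.log t / (v / Real.cos (Real.pi * α / 2))) (𝓝[>] 0)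
          (𝓝 (-Real.log t / (v / 1))) :=
        tendsto_const_nhds.div (tendsto_const_nhds.div tendsto_cos_half_pi_mul one_ne_zero)
          (by positivity)
      rw [div_one] at hw
      have h1 := (tendsto_stableLaw_rpow hst (by positivity) hw).const_sub 1
      have h2 : Real.exp (-(-Real.log t / v)) = t ^ (1 / v) := by
        rw [Real.rpow_def_of_pos ht0]
        ring_nf
      rw [h2] at h1
      refine h1.congr' ?_
      filter_upwards [eventually_mem_Ioo_zero_one] with α hα
      have hS := hst α hα.1 hα.2
      have hp := hS.isProbabilityMeasure
      have hcos := cos_half_pi_mul_pos hα.1 hα.2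
      rw [← probReal_compl_eq_one_sub (measurableSet_le (by fun_prop) (by fun_prop))]
      refine measureReal_congr (Filter.eventuallyEq_set.2 ?_)
      filter_upwards [hS.ae_pos hα.1 hα.2] with y hy
      have hyα : 0 < y ^ α := by positivity
      simp only [mem_compl_iff, mem_ofPred_eq, not_le]
      rw [← Real.log_lt_iff_lt_exp ht0, lt_neg, div_lt_iff₀ hyα, div_mul_eq_mul_div,
        one_lt_div (by positivity)]
  have hval : ∫ t in (0 : ℝ)..1, (1 - t ^ (1 / v)) = 1 / (1 + v) := by
    have : 0 < 1 / v := by positivity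
    rw [intervalIntegral.integral_sub intervalIntegrable_const
      (intervalIntegral.intervalIntegrable_rpow' (by linarith)),
      integral_rpow (Or.inl (by linarith)), Real.one_rpow, Real.zero_rpow (by positivity)]
    simp
    field_simp
    ring
  rw [hval] at hlim
  exact hlim.congr' hlayer

/-- Conditioning on `S₁ = x`, the Laplace transform of `S₂/x` at `v^(1/α)` is `exp (-v / (cos(πα/2)
x^α))`; its mean over `x` tends to `1/(1+v)` by the preceding limit. -/
theorem tendsto_stableLaw_ratio {u : ℝ} (hu : 0 < u) {w : ℝ → ℝ}
    (hw : Tendsto w (𝓝[>] 0) (𝓝 u)) :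
    Tendsto (fun α => ((stableLaw α).prod (stableLaw α)).real
      {p | w α * (p.2 / p.1) ^ α ≤ 1}) (𝓝[>] 0) (𝓝 (1 / (1 + u))) := by
  have hm : Measurable (fun p : ℝ × ℝ => p.2 / p.1) := by fun_prop
  have key := tendsto_measureReal_of_laplace (h := fun v => 1 / (1 + v)) (w := w) hu
    (ν := fun α => ((stableLaw α).prod (stableLaw α)).map fun p => p.2 / p.1) ?_ ?_ ?_ hw
  · refine key.congr fun α => ?_
    rw [measureReal_def, Measure.map_apply hm (measurableSet_le (by fun_prop) (by fun_prop))]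
    rfl
  · filter_upwards [eventually_mem_Ioo_zero_one] with α hα
    have hS := hst α hα.1 hα.2
    have hp := hS.isProbabilityMeasure
    refine ⟨Measure.isProbabilityMeasure_map hm.aemeasurable, ?_⟩
    rw [ae_map_iff hm.aemeasurable measurableSet_Ioi]
    have hpos := hS.ae_pos hα.1 hα.2
    filter_upwards [Measure.quasiMeasurePreserving_fst.ae hpos,
      Measure.quasiMeasurePreserving_snd.ae hpos] with p h1 h2
    exact div_pos h2 h1
  · intro v hv
    refine (tendsto_integral_exp_stableLaw_rpow hst hv).congr' ?_
    filter_upwards [eventually_mem_Ioo_zero_one] with α hα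
    have hS := hst α hα.1 hα.2
    have hp := hS.isProbabilityMeasure
    have hpos := hS.ae_pos hα.1 hα.2
    rw [integral_map hm.aemeasurable (by fun_prop), integral_prod]
    · refine integral_congr_ae ?_
      filter_upwards [hpos] with x hx
      have h1 : ∀ y : ℝ, v ^ (1 / α) * (y / x) = v ^ (1 / α) / x * y := fun y => by ring
      simp only [h1]
      rw [hS.integral_exp hα.1 hα.2 (by positivity), Real.div_rpow (by positivity) hx.le,
        ← Real.rpow_mul hv.le, one_div_mul_cancel hα.1.ne', Real.rpow_one]
      ring_nf
    · refine Integrable.mono' (integrable_const (1 : ℝ))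
        (Measurable.aestronglyMeasurable (by fun_prop)) ?_
      filter_upwards [Measure.quasiMeasurePreserving_fst.ae hpos,
        Measure.quasiMeasurePreserving_snd.ae hpos] with p h1 h2
      rw [Real.norm_eq_abs, abs_of_pos (Real.exp_pos _), Real.exp_le_one_iff, neg_nonpos]
      positivity
  · have : 1 + u ≠ 0 := by positivity
    fun_prop (disch := assumption)

end Limit

/-! ### The exact error probability -/

/-- The Bernoulli law on `{0, 1} ⊆ ℝ` with parameter `γ`. -/
noncomputable def bernoulliLaw (γ : ℝ) : Measure ℝ :=
  ENNReal.ofReal γ • Measure.dirac 1 + ENNReal.ofReal (1 - γ) • Measure.dirac 0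

lemma isProbabilityMeasure_bernoulliLaw {γ : ℝ} (h0 : 0 < γ) (h1 : γ ≤ 1) :
    IsProbabilityMeasure (bernoulliLaw γ) := by
  constructor
  simp only [bernoulliLaw, Measure.add_apply, Measure.smul_apply, measure_univ, smul_eq_mul,
    mul_one]
  rw [← ENNReal.ofReal_add h0.le (by linarith)]
  simp

lemma ae_bernoulliLaw (γ : ℝ) : ∀ᵐ x ∂(bernoulliLaw γ), x = 0 ∨ x = 1 := by
  rw [ae_iff]
  simp [bernoulliLaw]

lemma integral_bernoulliLaw {γ : ℝ} (h0 : 0 < γ) (h1 : γ ≤ 1) (f : ℝ → ℝ) :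
    ∫ x, f x ∂(bernoulliLaw γ) = γ * f 1 + (1 - γ) * f 0 := by
  have hi : ∀ a : ℝ, ∀ c : ℝ, Integrable f (ENNReal.ofReal c • Measure.dirac a) := fun a c =>
    (integrable_dirac (by simp)).smul_measure ENNReal.ofReal_ne_top
  rw [bernoulliLaw, integral_add_measure (hi _ _) (hi _ _), integral_smul_measure,
    integral_smul_measure, integral_dirac, integral_dirac, ENNReal.toReal_ofReal h0.le,
    ENNReal.toReal_ofReal (by linarith)]
  rfl

lemma eq_bernoulliLaw {γ : ℝ} (h0 : 0 < γ) (h1 : γ ≤ 1) {μ : Measure ℝ} [IsProbabilityMeasure μ]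
    (hone : μ {1} = ENNReal.ofReal γ) (hzero : μ {0} = ENNReal.ofReal (1 - γ)) :
    μ = bernoulliLaw γ := by
  have hd : Disjoint ({1} : Set ℝ) {0} := by simp
  have hu : μ ({1} ∪ {0}) = 1 := by
    rw [measure_union hd (measurableSet_singleton 0), hone, hzero,
      ← ENNReal.ofReal_add h0.le (by linarith)]
    simp
  have hae : ∀ᵐ x ∂μ, x ∈ ({1} ∪ {0} : Set ℝ) :=
    (prob_compl_eq_zero_iff (by measurability)).2 hu
  rw [bernoulliLaw, ← hone, ← hzero, ← Measure.restrict_singleton, ← Measure.restrict_singleton,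
    ← Measure.restrict_union hd (measurableSet_singleton 0), Measure.restrict_eq_self_of_ae_mem hae]

/-- The probability that `b^(1/α) S₂ / S₁ ≤ ε` for independent `S₁, S₂ ∼ S(α,1,1)`. -/
noncomputable def ratioProb (α ε b : ℝ) : ℝ :=
  ((stableLaw α).prod (stableLaw α)).real {p : ℝ × ℝ | b ^ (1 / α) * (p.2 / p.1) ≤ ε}

lemma rpow_inv_mul_le_iff {α b y ε : ℝ} (h0 : 0 < α) (hb : 0 ≤ b) (hy : 0 < y) (hε : 0 < ε) :
    b ^ (1 / α) * y ≤ ε ↔ b / ε ^ α * y ^ α ≤ 1 := by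
  have hεα : 0 < ε ^ α := by positivity
  rw [← Real.rpow_le_rpow_iff (by positivity) hε.le h0, Real.mul_rpow (by positivity) hy.le,
    ← Real.rpow_mul hb, one_div_mul_cancel h0.ne', Real.rpow_one, div_mul_eq_mul_div,
    div_le_one hεα]

lemma ratioProb_nonneg (α ε b : ℝ) : 0 ≤ ratioProb α ε b := measureReal_nonneg

lemma ratioProb_le_one {α : ℝ} (hS : IsMaxSkewedStable α (stableLaw α)) (ε b : ℝ) :
    ratioProb α ε b ≤ 1 := by
  have := hS.isProbabilityMeasure
  exact measureReal_le_one

lemma measurable_ratioProb {α : ℝ} (hS : IsMaxSkewedStable α (stableLaw α)) (ε : ℝ) :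
    Measurable (ratioProb α ε) := by
  have := hS.isProbabilityMeasure
  have hm : MeasurableSet {q : ℝ × (ℝ × ℝ) | q.1 ^ (1 / α) * (q.2.2 / q.2.1) ≤ ε} :=
    measurableSet_le (by fun_prop) (by fun_prop)
  exact (measurable_measure_prodMk_left (ν := (stableLaw α).prod (stableLaw α)) hm).ennreal_toReal

lemma ratioProb_zero {α : ℝ} (h0 : 0 < α) (hS : IsMaxSkewedStable α (stableLaw α))
    {ε : ℝ} (hε : 0 < ε) : ratioProb α ε 0 = 1 := by
  have := hS.isProbabilityMeasure
  simp only [ratioProb, Real.zero_rpow (one_div_ne_zero h0.ne'), zero_mul, hε.le]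
  simp

/-- Weighted sums of independent `S(α,1,1)` variables with nonnegative weights. -/
theorem map_sum_stableLaw {α : ℝ} (h0 : 0 < α) (hS : IsMaxSkewedStable α (stableLaw α))
    {ι : Type*} [Fintype ι] (s : Finset ι) {a : ι → ℝ} (ha : ∀ t, 0 ≤ a t) :
    (Measure.pi fun _ : ι => stableLaw α).map (fun σ => ∑ t ∈ s, a t * σ t) =
      (stableLaw α).map fun y => (∑ t ∈ s, a t ^ α) ^ (1 / α) * y := by
  have := hS.isProbabilityMeasure
  have hη : 0 ≤ ∑ t ∈ s, a t ^ α := Finset.sum_nonneg fun t _ => by have := ha t; positivity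
  have hind : iIndepFun (fun t (σ : ι → ℝ) => a t * σ t) (Measure.pi fun _ : ι => stableLaw α) :=
    iIndepFun_pi (X := fun t (y : ℝ) => a t * y) fun t => by fun_prop
  have hlaw : ∀ t, (Measure.pi fun _ : ι => stableLaw α).map (fun σ => a t * σ t) =
      (stableLaw α).map (a t * ·) := fun t => by
    have h := (measurePreserving_eval (fun _ : ι => stableLaw α) t).map_eq
    conv_rhs => rw [← h]
    rw [Measure.map_map (by fun_prop) (by fun_prop)]
    rfl
  -- Scaling by `c ≥ 0` multiplies the exponent by `c^α` without affecting the skewness; hence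
  -- exponents of independent summands add as `a t ^ α`.
  have hscale : ∀ c : ℝ, 0 ≤ c → ∀ u : ℝ, charFun ((stableLaw α).map (c * ·)) u =
      Complex.exp (((c ^ α : ℝ) : ℂ) * (-((|u| ^ α : ℝ) : ℂ) *
        (1 - Complex.I * ((Real.sign u * Real.tan (Real.pi * α / 2) : ℝ) : ℂ)))) := by
    intro c hc u
    rw [charFun_map_mul, hS.charFun_eq]
    congr 1
    rcases hc.eq_or_lt with rfl | hc
    · simp [Real.zero_rpow h0.ne']
    · have hsign : Real.sign (c * u) = Real.sign u := by
        rcases lt_trichotomy u 0 with hu | rfl | hu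
        · rw [Real.sign_of_neg hu, Real.sign_of_neg (mul_neg_of_pos_of_neg hc hu)]
        · simp
        · rw [Real.sign_of_pos hu, Real.sign_of_pos (mul_pos hc hu)]
      rw [hsign, abs_mul, abs_of_pos hc, Real.mul_rpow hc.le (abs_nonneg u)]
      push_cast
      ring
  have hmsum : Measurable fun σ : ι → ℝ => ∑ t ∈ s, a t * σ t :=
    Finset.measurable_fun_sum s fun t _ => by fun_prop
  have hterm : ∀ t ∈ s, AEMeasurable (fun σ : ι → ℝ => a t * σ t)
      (Measure.pi fun _ : ι => stableLaw α) := fun t _ => by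
    have : Measurable fun σ : ι → ℝ => a t * σ t := by fun_prop
    exact this.aemeasurable
  have hf1 : IsProbabilityMeasure
      ((Measure.pi fun _ : ι => stableLaw α).map (fun σ => ∑ t ∈ s, a t * σ t)) :=
    Measure.isProbabilityMeasure_map hmsum.aemeasurable
  have hf2 : IsProbabilityMeasure
      ((stableLaw α).map fun y => (∑ t ∈ s, a t ^ α) ^ (1 / α) * y) :=
    Measure.isProbabilityMeasure_map (by fun_prop)
  apply Measure.ext_of_charFun
  rw [iIndepFun.charFun_map_fun_finsetSum_eq_prod hterm
    (iIndepFun_iff_finset.1 hind s)]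
  funext u
  rw [Finset.prod_apply, hscale _ (by positivity), ← Real.rpow_mul hη, one_div_mul_cancel h0.ne',
    Real.rpow_one]
  simp only [hlaw]
  rw [Finset.prod_congr rfl fun t _ => hscale (a t) (ha t) u, ← Complex.exp_sum,
    ← Finset.sum_mul]
  push_cast
  rfl

theorem pi_stableLaw_ratio {α : ℝ} (h0 : 0 < α) (hS : IsMaxSkewedStable α (stableLaw α))
    {ι : Type*} [Fintype ι] [DecidableEq ι] {a : ι → ℝ}
    (ha : ∀ t, 0 ≤ a t) (i : ι) (ε : ℝ) :
    (Measure.pi fun _ : ι => stableLaw α)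
        {σ | (∑ t ∈ Finset.univ.erase i, a t * σ t) / σ i ≤ ε} =
      ENNReal.ofReal (ratioProb α ε (∑ t ∈ Finset.univ.erase i, a t ^ α)) := by
  have := hS.isProbabilityMeasure
  set η := ∑ t ∈ Finset.univ.erase i, a t ^ α with hη
  -- Weight `1` at `i` makes the excluded variable `σ i` itself, so the lemma on finite sums applies
  -- directly.
  have hind : iIndepFun (fun t (σ : ι → ℝ) => (if t = i then 1 else a t) * σ t)
      (Measure.pi fun _ : ι => stableLaw α) :=
    iIndepFun_pi (X := fun t (y : ℝ) => (if t = i then 1 else a t) * y) fun t => by fun_prop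
  have h2 := hind.indepFun_finsetSum_of_notMem (fun t => by fun_prop)
    (s := Finset.univ.erase i) (i := i) (by simp)
  have e1 : (∑ t ∈ Finset.univ.erase i,
      fun (σ : ι → ℝ) => (if t = i then 1 else a t) * σ t) =
      fun σ => ∑ t ∈ Finset.univ.erase i, a t * σ t := by
    funext σ
    rw [Finset.sum_apply]
    refine Finset.sum_congr rfl fun t ht => ?_
    rw [if_neg (Finset.ne_of_mem_erase ht)]
  have e2 : (fun σ : ι → ℝ => (if i = i then 1 else a i) * σ i) = Function.eval i := by
    funext σ; simp
  rw [e1, e2] at h2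
  have hmsum : Measurable fun σ : ι → ℝ => ∑ t ∈ Finset.univ.erase i, a t * σ t :=
    Finset.measurable_fun_sum _ fun t _ => by fun_prop
  have h3 := (indepFun_iff_map_prod_eq_prod_map_map
    (measurable_pi_apply i).aemeasurable hmsum.aemeasurable).1 h2.symm
  rw [(measurePreserving_eval (fun _ : ι => stableLaw α) i).map_eq,
    map_sum_stableLaw h0 hS _ ha, ← hη] at h3
  have hm : MeasurableSet {p : ℝ × ℝ | p.2 / p.1 ≤ ε} :=
    measurableSet_le (by fun_prop) (by fun_prop)
  have h4 : (Measure.pi fun _ : ι => stableLaw α)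
      {σ | (∑ t ∈ Finset.univ.erase i, a t * σ t) / σ i ≤ ε} =
      ((Measure.pi fun _ : ι => stableLaw α).map fun σ =>
        (Function.eval i σ, ∑ t ∈ Finset.univ.erase i, a t * σ t)) {p | p.2 / p.1 ≤ ε} := by
    rw [Measure.map_apply ((measurable_pi_apply i).prodMk hmsum) hm]
    rfl
  rw [h4, h3, ratioProb, ofReal_measureReal]
  have h5 : (stableLaw α).prod ((stableLaw α).map fun y => η ^ (1 / α) * y) =
      ((stableLaw α).prod (stableLaw α)).map (Prod.map id fun y => η ^ (1 / α) * y) := by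
    rw [← Measure.map_prod_map _ _ measurable_id (by fun_prop), Measure.map_id]
  rw [h5, Measure.map_apply (by fun_prop) hm]
  congr 1
  ext p
  simp [mul_div_assoc]

/-! ### Passing between `ratioProb` and `F_α` -/

section Stable

variable {α : ℝ} (h0 : 0 < α) (h1 : α < 1) (hS : IsMaxSkewedStable α (stableLaw α))
include h0 h1 hS

lemma ae_prod_stableLaw_pos :
    ∀ᵐ p : ℝ × ℝ ∂((stableLaw α).prod (stableLaw α)), 0 < p.1 ∧ 0 < p.2 := by
  have := hS.isProbabilityMeasure
  have hpos := hS.ae_pos h0 h1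
  exact (Measure.quasiMeasurePreserving_fst.ae hpos).and
    (Measure.quasiMeasurePreserving_snd.ae hpos)

lemma ratioProb_eq {b ε : ℝ} (hb : 0 ≤ b) (hε : 0 < ε) :
    ratioProb α ε b = ((stableLaw α).prod (stableLaw α)).real
      {p | b / ε ^ α * (p.2 / p.1) ^ α ≤ 1} := by
  refine measureReal_congr (Filter.eventuallyEq_set.2 ?_)
  filter_upwards [ae_prod_stableLaw_pos h0 h1 hS] with p hp
  exact rpow_inv_mul_le_iff h0 hb (div_pos hp.2 hp.1) hε

/-- On positive ratios the common exponent `1/(1-α)` can be removed from both sides. For `b = 0` the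
argument of `F_α` is `∞` and both probabilities are `1`. -/
theorem ratioCDF_eq_ratioProb {b ε : ℝ} (hb : 0 ≤ b) (hε : 0 < ε) :
    ratioCDF α ((ENNReal.ofReal (ε ^ α) / ENNReal.ofReal b) ^ (1 / (1 - α))) =
      ratioProb α ε b := by
  have h1' : 0 < 1 - α := by linarith
  have hεα : 0 < ε ^ α := by positivity
  rw [ratioProb_eq h0 h1 hS hb hε, ratioCDF]
  refine measureReal_congr (Filter.eventuallyEq_set.2 ?_)
  filter_upwards [ae_prod_stableLaw_pos h0 h1 hS] with p hp
  have hy : 0 < p.2 / p.1 := div_pos hp.2 hp.1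
  change ENNReal.ofReal ((p.2 / p.1) ^ (α / (1 - α))) ≤ _ ↔ b / ε ^ α * (p.2 / p.1) ^ α ≤ 1
  generalize p.2 / p.1 = y at hy ⊢
  rcases hb.eq_or_lt with rfl | hb
  · rw [ENNReal.ofReal_zero, ENNReal.div_zero (by simpa using hεα),
      ENNReal.top_rpow_of_pos (by positivity)]
    simp
  · rw [← ENNReal.ofReal_div_of_pos hb, ENNReal.ofReal_rpow_of_pos (by positivity),
      ENNReal.ofReal_le_ofReal_iff (by positivity), div_eq_mul_one_div α, Real.rpow_mul hy.le,
      Real.rpow_le_rpow_iff (by positivity) (by positivity) (by positivity), le_div_iff₀ hb,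
      div_mul_eq_mul_div, div_le_one hεα, mul_comm]

end Stable

/-! ### Reduction to single columns -/

section Columns

variable {N M : ℕ} {Ω : Type*}

/-- The entries of one column of the design: the variables `s` and then the variables `r`. -/
def column (s r : Fin N → Fin M → Ω → ℝ) (j : Fin M) (k : Fin N ⊕ Fin N) (ω : Ω) : ℝ :=
  Sum.elim (fun t => s t j ω) (fun t => r t j ω) k

/-- The columns for which the estimate is at most `x i + ε`. -/
def goodColumns (x : Fin N → ℝ) (i : Fin N) (ε : ℝ) : Set (Fin N ⊕ Fin N → ℝ) :=
  {c | c (Sum.inr i) = 1 ∧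
    (∑ t, x t * (c (Sum.inl t) * c (Sum.inr t))) / (c (Sum.inl i) * c (Sum.inr i)) ≤ x i + ε}

/-- A finite infimum preserves strict lower bounds tested term by term; the empty infimum is `⊤`,
which exceeds every real number. -/
lemma lt_estimator_iff {s r : Fin N → Fin M → Ω → ℝ} (x : Fin N → ℝ) (i : Fin N) (ε : ℝ)
    (ω : Ω) :
    ((x i + ε : ℝ) : EReal) < estimator x s r i ω ↔
      ∀ j, (fun k => column s r j k ω) ∉ goodColumns x i ε := by
  classical
  have h1 : estimator x s r i ω = (Finset.univ.filter fun j => r i j ω = 1).inf fun j =>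
      ((measurement x s r j ω / (s i j ω * r i j ω) : ℝ) : EReal) := by
    rw [Finset.inf_eq_iInf, estimator]
    simp
  rw [h1, Finset.lt_inf_iff (EReal.coe_lt_top _)]
  refine forall_congr' fun j => ?_
  simp only [Finset.mem_filter, Finset.mem_univ, true_and, EReal.coe_lt_coe_iff]
  change (r i j ω = 1 → _) ↔ ¬(r i j ω = 1 ∧ measurement x s r j ω / (s i j ω * r i j ω) ≤ x i + ε)
  rw [not_and, not_le]

end Columns

/-! ### Laws of the columns and the exact formula -/

section Design

variable {N M : ℕ} {Ω : Type*} [MeasurableSpace Ω] {α γ : ℝ} {P : Measure Ω}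
  {s r : Fin N → Fin M → Ω → ℝ}

/-- The laws of the entries of one column of the design. -/
noncomputable def columnLaw (N : ℕ) (α γ : ℝ) : Fin N ⊕ Fin N → Measure ℝ :=
  Sum.elim (fun _ => stableLaw α) (fun _ => bernoulliLaw γ)

namespace IsSparseDesign

variable (h : IsSparseDesign α γ P s r) (hγ0 : 0 < γ) (hγ1 : γ ≤ 1)
include h

lemma measurable_column (j : Fin M) (k : Fin N ⊕ Fin N) : Measurable (column s r j k) := by
  rcases k with t | t
  · exact h.measurable_s t j
  · exact h.measurable_r t j

include hγ0 hγ1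

lemma map_column (j : Fin M) (k : Fin N ⊕ Fin N) :
    P.map (column s r j k) = columnLaw N α γ k := by
  have := h.isProbabilityMeasure
  rcases k with t | t
  · exact (h.law_s t j).eq_stableLaw
  · have := Measure.isProbabilityMeasure_map (μ := P) (h.measurable_r t j).aemeasurable
    refine eq_bernoulliLaw hγ0 hγ1 (μ := P.map (r t j)) ?_ ?_
    · rw [Measure.map_apply (h.measurable_r t j) (measurableSet_singleton 1), ← h.prob_r_one t j]
      rfl
    · rw [Measure.map_apply (h.measurable_r t j) (measurableSet_singleton 0), ← h.prob_r_zero t j]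
      rfl

/-- The columns of the design are independent and identically distributed. -/
theorem map_columns (hν : ∀ k, IsProbabilityMeasure (columnLaw N α γ k)) :
    P.map (fun ω j k => column s r j k ω) =
      Measure.pi fun _ : Fin M => Measure.pi (columnLaw N α γ) := by
  have := h.isProbabilityMeasure
  have hm := h.measurable_column
  -- Regrouping all entries by column over a sigma type lets the joint product law be curried into a
  -- product of column laws.
  set g : (_ : Fin M) × (Fin N ⊕ Fin N) → (Fin N × Fin M) ⊕ (Fin N × Fin M) := fun p =>
    Sum.map (fun t => (t, p.1)) (fun t => (t, p.1)) p.2 with hg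
  have hinj : Function.Injective g := by
    rintro ⟨j, t | t⟩ ⟨j', t' | t'⟩ hjt <;> simp_all
  have h1 := h.indep.precomp hinj
  have h2 : iIndepFun (fun (p : (_ : Fin M) × (Fin N ⊕ Fin N)) => column s r p.1 p.2) P := by
    convert h1 using 2 with p
    rcases p with ⟨j, t | t⟩ <;> rfl
  have h3 := (iIndepFun_iff_map_fun_eq_infinitePi_map
    (X := fun (p : (_ : Fin M) × (Fin N ⊕ Fin N)) => column s r p.1 p.2)
    (fun p => hm p.1 p.2)).1 h2
  simp only [h.map_column hγ0 hγ1] at h3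
  have h4 := Measure.infinitePi_map_piCurry (fun (_ : Fin M) k => columnLaw N α γ k)
  rw [← h3, Measure.map_map (by fun_prop) (by fun_prop)] at h4
  rw [← Measure.infinitePi_eq_pi, ← Measure.infinitePi_eq_pi, ← h4]
  rfl

/-- The law of the Bernoulli entries of a column. -/
theorem map_bernoulli_column (j : Fin M) :
    P.map (fun ω t => r t j ω) = Measure.pi fun _ : Fin N => bernoulliLaw γ := by
  have := h.isProbabilityMeasure
  have hinj : Function.Injective
      (fun t => Sum.inr (t, j) : Fin N → (Fin N × Fin M) ⊕ (Fin N × Fin M)) := fun t t' htt => by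
    simpa using htt
  have h2 : iIndepFun (fun t => r t j) P := h.indep.precomp hinj
  rw [h2.map_fun_eq_pi_map fun t => (h.measurable_r t j).aemeasurable]
  congr 1 with t : 1
  exact h.map_column hγ0 hγ1 j (Sum.inr t)

end IsSparseDesign

lemma measurableSet_goodColumns (x : Fin N → ℝ) (i : Fin N) (ε : ℝ) :
    MeasurableSet (goodColumns x i ε) := by
  refine MeasurableSet.inter ?_ ?_
  · exact measurableSet_eq_fun (measurable_pi_apply _) measurable_const
  · have h1 : Measurable fun c : Fin N ⊕ Fin N → ℝ =>
        ∑ t, x t * (c (Sum.inl t) * c (Sum.inr t)) :=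
      Finset.measurable_fun_sum _ fun t _ => by fun_prop
    have h2 : Measurable fun c : Fin N ⊕ Fin N → ℝ => c (Sum.inl i) * c (Sum.inr i) := by fun_prop
    exact measurableSet_le (h1.div h2) measurable_const

/-- `η` as a function of the Bernoulli entries of a column. -/
noncomputable def columnEta (α : ℝ) (x : Fin N → ℝ) (i : Fin N) (ρ : Fin N → ℝ) : ℝ :=
  ∑ t ∈ Finset.univ.erase i, x t ^ α * ρ t

lemma measurable_columnEta (α : ℝ) (x : Fin N → ℝ) (i : Fin N) :
    Measurable (columnEta α x i) :=
  Finset.measurable_fun_sum _ fun t _ => by fun_prop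

lemma ae_pi_bernoulliLaw (hγ0 : 0 < γ) (hγ1 : γ ≤ 1) :
    ∀ᵐ ρ ∂(Measure.pi fun _ : Fin N => bernoulliLaw γ), ∀ t, ρ t = 0 ∨ ρ t = 1 := by
  have := isProbabilityMeasure_bernoulliLaw hγ0 hγ1
  refine ae_all_iff.2 fun t => ?_
  exact (measurePreserving_eval (fun _ : Fin N => bernoulliLaw γ) t).quasiMeasurePreserving.ae
    (ae_bernoulliLaw γ)

lemma columnEta_nonneg {x : Fin N → ℝ} (hx : ∀ t, 0 ≤ x t) {ρ : Fin N → ℝ}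
    (hρ : ∀ t, ρ t = 0 ∨ ρ t = 1) (α : ℝ) (i : Fin N) : 0 ≤ columnEta α x i ρ := by
  refine Finset.sum_nonneg fun t _ => ?_
  have h1 : 0 ≤ x t ^ α := Real.rpow_nonneg (hx t) α
  rcases hρ t with h | h <;> simp [h, h1]

/-- Given the Bernoulli entries, the conditional probability of a good column. -/
lemma pi_stableLaw_goodColumns (h0 : 0 < α) (h1 : α < 1)
    (hS : IsMaxSkewedStable α (stableLaw α)) {x : Fin N → ℝ} (hx : ∀ t, 0 ≤ x t) (i : Fin N)
    (ε : ℝ) {ρ : Fin N → ℝ} (hρ : ∀ t, ρ t = 0 ∨ ρ t = 1) :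
    (Measure.pi fun _ : Fin N => stableLaw α) {σ | Sum.elim σ ρ ∈ goodColumns x i ε} =
      ENNReal.ofReal (ρ i * ratioProb α ε (columnEta α x i ρ)) := by
  have := hS.isProbabilityMeasure
  rcases hρ i with hi | hi
  · simp [goodColumns, hi]
  have ha : ∀ t, 0 ≤ x t * ρ t := fun t => by rcases hρ t with h | h <;> simp [h, hx t]
  -- `ρ t ^ α = ρ t` for `ρ t ∈ {0, 1}`, as `α ≠ 0`.
  have hη : columnEta α x i ρ = ∑ t ∈ Finset.univ.erase i, (x t * ρ t) ^ α := by
    refine Finset.sum_congr rfl fun t _ => ?_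
    rcases hρ t with h | h <;> simp [h, Real.zero_rpow h0.ne']
  rw [hi, one_mul, hη, ← pi_stableLaw_ratio h0 hS ha i ε]
  refine measure_congr (Filter.eventuallyEq_set.2 ?_)
  filter_upwards [(measurePreserving_eval (fun _ : Fin N => stableLaw α) i).quasiMeasurePreserving.ae
    (hS.ae_pos h0 h1)] with σ hσ
  have hσ : 0 < σ i := hσ
  change (ρ i = 1 ∧ (∑ t, x t * (σ t * ρ t)) / (σ i * ρ i) ≤ x i + ε) ↔
    (∑ t ∈ Finset.univ.erase i, x t * ρ t * σ t) / σ i ≤ ε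
  rw [← Finset.add_sum_erase _ _ (Finset.mem_univ i), hi]
  have h2 : ∑ t ∈ Finset.univ.erase i, x t * (σ t * ρ t) =
      ∑ t ∈ Finset.univ.erase i, x t * ρ t * σ t :=
    Finset.sum_congr rfl fun t _ => by ring
  rw [h2, mul_one, add_div, mul_div_cancel_right₀ _ hσ.ne']
  simp

/-- `columnEta` omits the index `i`, hence is independent of `ρ i`, whose mean is `γ`. -/
lemma integral_bernoulli_mul_ratioProb (hγ0 : 0 < γ) (hγ1 : γ ≤ 1)
    (hS : IsMaxSkewedStable α (stableLaw α)) (x : Fin N → ℝ) (i : Fin N) (ε : ℝ) :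
    ∫ ρ, ρ i * ratioProb α ε (columnEta α x i ρ) ∂(Measure.pi fun _ : Fin N => bernoulliLaw γ) =
      γ * ∫ ρ, ratioProb α ε (columnEta α x i ρ)
        ∂(Measure.pi fun _ : Fin N => bernoulliLaw γ) := by
  have := isProbabilityMeasure_bernoulliLaw hγ0 hγ1
  have hind : iIndepFun (fun t (ρ : Fin N → ℝ) => (if t = i then 1 else x t ^ α) * ρ t)
      (Measure.pi fun _ : Fin N => bernoulliLaw γ) :=
    iIndepFun_pi (X := fun t (y : ℝ) => (if t = i then 1 else x t ^ α) * y) fun t => by fun_prop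
  have h2 := hind.indepFun_finsetSum_of_notMem (fun t => by fun_prop)
    (s := Finset.univ.erase i) (i := i) (by simp)
  have e1 : (∑ t ∈ Finset.univ.erase i,
      fun (ρ : Fin N → ℝ) => (if t = i then 1 else x t ^ α) * ρ t) = columnEta α x i := by
    funext ρ
    rw [Finset.sum_apply, columnEta]
    refine Finset.sum_congr rfl fun t ht => ?_
    rw [if_neg (Finset.ne_of_mem_erase ht)]
  have e2 : (fun ρ : Fin N → ℝ => (if i = i then 1 else x i ^ α) * ρ i) = fun ρ => ρ i := by
    funext ρ; simp
  rw [e1, e2] at h2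
  have h3 := h2.symm.comp measurable_id (measurable_ratioProb hS ε)
  have h4 := h3.integral_fun_mul_eq_mul_integral
    (measurable_id.comp (measurable_pi_apply i)).aestronglyMeasurable
    ((measurable_ratioProb hS ε).comp (measurable_columnEta α x i)).aestronglyMeasurable
  simp only [Function.comp_apply, id] at h4
  rw [h4]
  congr 1
  have h5 := (measurePreserving_eval (fun _ : Fin N => bernoulliLaw γ) i).map_eq
  have h6 := integral_map (μ := Measure.pi fun _ : Fin N => bernoulliLaw γ)
    (measurable_pi_apply i).aemeasurable (f := fun y : ℝ => y) (by fun_prop)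
  rw [← h6]
  change Measure.map (fun ρ : Fin N → ℝ => ρ i) _ = bernoulliLaw γ at h5
  rw [h5, integral_bernoulliLaw hγ0 hγ1 fun y => y]
  simp

lemma pi_columnLaw_goodColumns (h0 : 0 < α) (h1 : α < 1) (hγ0 : 0 < γ) (hγ1 : γ ≤ 1)
    (hS : IsMaxSkewedStable α (stableLaw α)) {x : Fin N → ℝ} (hx : ∀ t, 0 ≤ x t) (i : Fin N)
    (ε : ℝ) (hν : ∀ k, IsProbabilityMeasure (columnLaw N α γ k)) :
    (Measure.pi (columnLaw N α γ)).real (goodColumns x i ε) =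
      γ * ∫ ρ, ratioProb α ε (columnEta α x i ρ)
        ∂(Measure.pi fun _ : Fin N => bernoulliLaw γ) := by
  have := isProbabilityMeasure_bernoulliLaw hγ0 hγ1
  have := hS.isProbabilityMeasure
  have hG := measurableSet_goodColumns x i ε
  have hmp := measurePreserving_sumPiEquivProdPi_symm (columnLaw N α γ)
  have e := hmp.measure_preimage hG.nullMeasurableSet
  rw [measureReal_def, ← e]
  change (((Measure.pi fun _ : Fin N => stableLaw α).prod
    (Measure.pi fun _ : Fin N => bernoulliLaw γ)) _).toReal = _
  rw [Measure.prod_apply_symm (hmp.measurable hG)]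
  have h2 : ∀ᵐ ρ ∂(Measure.pi fun _ : Fin N => bernoulliLaw γ),
      (Measure.pi fun _ : Fin N => stableLaw α) ((fun σ => (σ, ρ)) ⁻¹'
        ((MeasurableEquiv.sumPiEquivProdPi fun _ : Fin N ⊕ Fin N => ℝ).symm ⁻¹'
          goodColumns x i ε)) =
        ENNReal.ofReal (ρ i * ratioProb α ε (columnEta α x i ρ)) := by
    filter_upwards [ae_pi_bernoulliLaw hγ0 hγ1] with ρ hρ
    rw [← pi_stableLaw_goodColumns h0 h1 hS hx i ε hρ]
    congr 1
  rw [lintegral_congr_ae h2, ← integral_bernoulli_mul_ratioProb hγ0 hγ1 hS,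
    integral_eq_lintegral_of_nonneg_ae]
  · filter_upwards [ae_pi_bernoulliLaw hγ0 hγ1] with ρ hρ
    have := ratioProb_nonneg α ε (columnEta α x i ρ)
    rcases hρ i with h | h <;> simp [h, this]
  · exact ((measurable_pi_apply i).mul
      ((measurable_ratioProb hS ε).comp (measurable_columnEta α x i))).aestronglyMeasurable

/-- An error means that none of the `M` independent, identically distributed columns is good. -/
theorem IsSparseDesign.errorProb_eq (h : IsSparseDesign α γ P s r) (hγ0 : 0 < γ) (hγ1 : γ ≤ 1)
    (h0 : 0 < α) (h1 : α < 1) (hS : IsMaxSkewedStable α (stableLaw α)) {x : Fin N → ℝ}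
    (hx : ∀ t, 0 ≤ x t) (i : Fin N) (ε : ℝ) :
    errorProb P x s r i ε =
      (1 - γ * ∫ ρ, ratioProb α ε (columnEta α x i ρ)
        ∂(Measure.pi fun _ : Fin N => bernoulliLaw γ)) ^ M := by
  have hν : ∀ k, IsProbabilityMeasure (columnLaw N α γ k) := by
    rintro (t | t)
    · exact hS.isProbabilityMeasure
    · exact isProbabilityMeasure_bernoulliLaw hγ0 hγ1
  have hG := measurableSet_goodColumns x i ε
  have hm : Measurable fun ω j k => column s r j k ω :=
    measurable_pi_lambda _ fun j => measurable_pi_lambda _ fun k => h.measurable_column j k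
  have e : {ω | ((x i + ε : ℝ) : EReal) < estimator x s r i ω} =
      (fun ω j k => column s r j k ω) ⁻¹' (univ.pi fun _ => (goodColumns x i ε)ᶜ) := by
    ext ω
    rw [mem_ofPred_eq, lt_estimator_iff]
    simp
  rw [errorProb, e, measureReal_def,
    ← Measure.map_apply hm (MeasurableSet.univ_pi fun _ => hG.compl), h.map_columns hγ0 hγ1 hν,
    Measure.pi_pi, Finset.prod_const, ENNReal.toReal_pow, ← measureReal_def,
    probReal_compl_eq_one_sub hG, pi_columnLaw_goodColumns h0 h1 hγ0 hγ1 hS hx i ε hν]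
  simp

theorem IsSparseDesign.integral_ratioCDF (h : IsSparseDesign α γ P s r) (hγ0 : 0 < γ)
    (hγ1 : γ ≤ 1) (h0 : 0 < α) (h1 : α < 1) (hS : IsMaxSkewedStable α (stableLaw α))
    {x : Fin N → ℝ} (hx : ∀ t, 0 ≤ x t) (i : Fin N) {ε : ℝ} (hε : 0 < ε) (j : Fin M) :
    ∫ ω, ratioCDF α ((ENNReal.ofReal (ε ^ α) /
      ENNReal.ofReal (eta α x r i j ω)) ^ (1 / (1 - α))) ∂P =
      ∫ ρ, ratioProb α ε (columnEta α x i ρ)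
        ∂(Measure.pi fun _ : Fin N => bernoulliLaw γ) := by
  have hm : Measurable fun ω t => r t j ω := measurable_pi_lambda _ fun t => h.measurable_r t j
  have hae := ae_pi_bernoulliLaw (N := N) hγ0 hγ1
  rw [← h.map_bernoulli_column hγ0 hγ1 j] at hae ⊢
  rw [integral_map (f := fun ρ => ratioProb α ε (columnEta α x i ρ)) hm.aemeasurable
    ((measurable_ratioProb hS ε).comp (measurable_columnEta α x i)).aestronglyMeasurable]
  refine integral_congr_ae ?_
  filter_upwards [ae_of_ae_map hm.aemeasurable hae] with ω hω
  exact ratioCDF_eq_ratioProb h0 h1 hS (columnEta_nonneg hx hω α i) hε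

end Design

/-! ### Averages over the Bernoulli entries -/

section Bounds

variable {N M : ℕ} {γ : ℝ}

lemma integrable_pi_bernoulliLaw (hγ0 : 0 < γ) (hγ1 : γ ≤ 1) (s : Finset (Fin N)) (c : Fin N → ℝ) :
    Integrable (fun ρ : Fin N → ℝ => ∑ t ∈ s, c t * ρ t)
      (Measure.pi fun _ : Fin N => bernoulliLaw γ) := by
  have := isProbabilityMeasure_bernoulliLaw hγ0 hγ1
  refine integrable_finsetSum _ fun t _ => Integrable.const_mul ?_ _
  refine Integrable.mono' (integrable_const (1 : ℝ)) (measurable_pi_apply t).aestronglyMeasurable ?_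
  filter_upwards [ae_pi_bernoulliLaw hγ0 hγ1] with ρ hρ
  rcases hρ t with h | h <;> simp [h]

lemma integral_pi_bernoulliLaw (hγ0 : 0 < γ) (hγ1 : γ ≤ 1) (s : Finset (Fin N)) (c : Fin N → ℝ) :
    ∫ ρ, ∑ t ∈ s, c t * ρ t ∂(Measure.pi fun _ : Fin N => bernoulliLaw γ) =
      γ * ∑ t ∈ s, c t := by
  have := isProbabilityMeasure_bernoulliLaw hγ0 hγ1
  rw [integral_finsetSum, Finset.mul_sum]
  · refine Finset.sum_congr rfl fun t _ => ?_
    have h := (measurePreserving_eval (fun _ : Fin N => bernoulliLaw γ) t).map_eq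
    have h2 := integral_map (μ := Measure.pi fun _ : Fin N => bernoulliLaw γ)
      (measurable_pi_apply t).aemeasurable (f := fun y : ℝ => y) (by fun_prop)
    change Measure.map (fun ρ : Fin N → ℝ => ρ t) _ = bernoulliLaw γ at h
    rw [integral_const_mul, ← h2, h, integral_bernoulliLaw hγ0 hγ1 fun y => y]
    ring
  · intro t _
    simpa using integrable_pi_bernoulliLaw hγ0 hγ1 {t} c

/-! ### The case `α = 1/2` -/

lemma arctanTop_div {ε y : ℝ} (hε : 0 < ε) (hy : 0 ≤ y) :
    arctanTop (ENNReal.ofReal √ε / ENNReal.ofReal y) =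
      Real.pi / 2 - Real.arctan (y / √ε) := by
  have hs : 0 < √ε := Real.sqrt_pos.2 hε
  rcases hy.eq_or_lt with rfl | hy
  · rw [ENNReal.ofReal_zero, ENNReal.div_zero (by simpa using hε)]
    simp [arctanTop]
  · rw [← ENNReal.ofReal_div_of_pos hy, arctanTop, if_neg ENNReal.ofReal_ne_top,
      ENNReal.toReal_ofReal (by positivity), ← Real.arctan_inv_of_pos (by positivity), inv_div]

lemma concaveOn_arctan : ConcaveOn ℝ (Ici 0) Real.arctan := by
  refine AntitoneOn.concaveOn_of_deriv (convex_Ici 0) Real.continuous_arctan.continuousOn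
    Real.differentiable_arctan.differentiableOn ?_
  rw [interior_Ici, Real.deriv_arctan]
  intro a ha b hb hab
  have ha : 0 < a := ha
  simp only
  gcongr

lemma ratioProb_half {ε b : ℝ} (hε : 0 < ε) (hb : 0 ≤ b) :
    ratioProb (1 / 2) ε b = 1 - 2 / Real.pi * Real.arctan (b / √ε) := by
  rw [← stableLaw_half_ratio hb hε, ratioProb, one_div_one_div, Real.rpow_two]

lemma isMaxSkewedStable_stableLaw_half : IsMaxSkewedStable (1 / 2) (stableLaw (1 / 2)) := by
  have h := isMaxSkewedStable_half
  rwa [h.eq_stableLaw] at h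

/-- Jensen's inequality for the arctangent, concave on `[0,∞)`, together with the mean `γ ∑ √(x t)`
of `η`. -/
theorem arctan_le_integral_ratioProb_half (hγ0 : 0 < γ) (hγ1 : γ ≤ 1) {x : Fin N → ℝ}
    (hx : ∀ t, 0 ≤ x t) (i : Fin N) {ε : ℝ} (hε : 0 < ε) :
    1 - 2 / Real.pi * Real.arctan (γ * (∑ t ∈ Finset.univ.erase i, x t ^ (1 / 2 : ℝ)) / √ε) ≤
      ∫ ρ, ratioProb (1 / 2) ε (columnEta (1 / 2) x i ρ)
        ∂(Measure.pi fun _ : Fin N => bernoulliLaw γ) := by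
  have := isProbabilityMeasure_bernoulliLaw hγ0 hγ1
  have hae := ae_pi_bernoulliLaw (N := N) hγ0 hγ1
  have hmeas := measurable_columnEta (1 / 2) x i
  have hint : Integrable (fun ρ => Real.arctan (columnEta (1 / 2) x i ρ / √ε))
      (Measure.pi fun _ : Fin N => bernoulliLaw γ) := by
    refine Integrable.mono' (integrable_const (Real.pi / 2))
      (Real.measurable_arctan.comp (hmeas.div_const _)).aestronglyMeasurable ?_
    refine Eventually.of_forall fun ρ => ?_
    rw [Real.norm_eq_abs, abs_le]
    exact ⟨(Real.neg_pi_div_two_lt_arctan _).le, (Real.arctan_lt_pi_div_two _).le⟩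
  have hjensen := concaveOn_arctan.le_map_integral Real.continuous_arctan.continuousOn isClosed_Ici
    (f := fun ρ => columnEta (1 / 2) x i ρ / √ε)
    (μ := Measure.pi fun _ : Fin N => bernoulliLaw γ) (by
      filter_upwards [hae] with ρ hρ
      exact div_nonneg (columnEta_nonneg hx hρ _ i) (Real.sqrt_nonneg ε))
    ((integrable_pi_bernoulliLaw hγ0 hγ1 _ _).div_const _) hint
  rw [integral_div] at hjensen
  have hE : ∫ ρ, columnEta (1 / 2) x i ρ ∂(Measure.pi fun _ : Fin N => bernoulliLaw γ) =
      γ * ∑ t ∈ Finset.univ.erase i, x t ^ (1 / 2 : ℝ) :=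
    integral_pi_bernoulliLaw hγ0 hγ1 _ _
  rw [hE] at hjensen
  have heq : ∫ ρ, ratioProb (1 / 2) ε (columnEta (1 / 2) x i ρ)
      ∂(Measure.pi fun _ : Fin N => bernoulliLaw γ) =
      ∫ ρ, (1 - 2 / Real.pi * Real.arctan (columnEta (1 / 2) x i ρ / √ε))
        ∂(Measure.pi fun _ : Fin N => bernoulliLaw γ) := by
    refine integral_congr_ae ?_
    filter_upwards [hae] with ρ hρ
    exact ratioProb_half hε (columnEta_nonneg hx hρ _ i)
  rw [heq, integral_sub (integrable_const _) (hint.const_mul _), integral_const_mul]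
  simp only [integral_const, probReal_univ, smul_eq_mul, mul_one]
  gcongr

lemma integral_ratioProb_le_one (hγ0 : 0 < γ) (hγ1 : γ ≤ 1) {α : ℝ}
    (hS : IsMaxSkewedStable α (stableLaw α)) (x : Fin N → ℝ) (i : Fin N) (ε : ℝ) :
    ∫ ρ, ratioProb α ε (columnEta α x i ρ) ∂(Measure.pi fun _ : Fin N => bernoulliLaw γ) ≤ 1 := by
  have := isProbabilityMeasure_bernoulliLaw hγ0 hγ1
  have h := norm_integral_le_of_norm_le_const
    (μ := Measure.pi fun _ : Fin N => bernoulliLaw γ) (C := 1)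
    (f := fun ρ => ratioProb α ε (columnEta α x i ρ)) (Eventually.of_forall fun ρ => by
      rw [Real.norm_eq_abs, abs_of_nonneg (ratioProb_nonneg _ _ _)]
      exact ratioProb_le_one hS _ _)
  simp only [probReal_univ, mul_one] at h
  exact (le_abs_self _).trans h

theorem errorProb_half_le (hγ0 : 0 < γ) (hγ1 : γ ≤ 1) {x : Fin N → ℝ}
    (hx : ∀ t, 0 ≤ x t) (i : Fin N) {ε : ℝ} (hε : 0 < ε) {Ω : Type*} [MeasurableSpace Ω]
    {P : Measure Ω} {s r : Fin N → Fin M → Ω → ℝ} (h : IsSparseDesign (1 / 2) γ P s r) :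
    errorProb P x s r i ε ≤
      (1 - γ * (2 / Real.pi) * arctanTop (ENNReal.ofReal √ε /
        ENNReal.ofReal (γ * ∑ t ∈ Finset.univ.erase i, x t ^ (1 / 2 : ℝ)))) ^ M := by
  have hS := isMaxSkewedStable_stableLaw_half
  have hsum : 0 ≤ γ * ∑ t ∈ Finset.univ.erase i, x t ^ (1 / 2 : ℝ) :=
    mul_nonneg hγ0.le (Finset.sum_nonneg fun t _ => Real.rpow_nonneg (hx t) _)
  rw [h.errorProb_eq hγ0 hγ1 (by norm_num) (by norm_num) hS hx i ε, arctanTop_div hε hsum]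
  have h1 := arctan_le_integral_ratioProb_half hγ0 hγ1 hx i hε
  have h2 := integral_ratioProb_le_one hγ0 hγ1 hS x i ε
  have h3 := mul_le_mul_of_nonneg_left h1 hγ0.le
  refine pow_le_pow_left₀ ?_ ?_ M
  · nlinarith
  · have h4 : γ * (2 / Real.pi) * (Real.pi / 2 - Real.arctan
        (γ * (∑ t ∈ Finset.univ.erase i, x t ^ (1 / 2 : ℝ)) / √ε)) =
        γ * (1 - 2 / Real.pi * Real.arctan
          (γ * (∑ t ∈ Finset.univ.erase i, x t ^ (1 / 2 : ℝ)) / √ε)) := by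
      field_simp
    linarith

lemma one_sub_arctanTop_pow_mono (hγ0 : 0 < γ) (hγ1 : γ ≤ 1) {ε a b : ℝ} (hε : 0 < ε)
    (ha : 0 ≤ a) (hab : a ≤ b) (M : ℕ) :
    (1 - γ * (2 / Real.pi) * arctanTop (ENNReal.ofReal √ε / ENNReal.ofReal a)) ^ M ≤
      (1 - γ * (2 / Real.pi) * arctanTop (ENNReal.ofReal √ε / ENNReal.ofReal b)) ^ M := by
  rw [arctanTop_div hε ha, arctanTop_div hε (ha.trans hab)]
  have h1 : 0 ≤ Real.arctan (a / √ε) := Real.arctan_nonneg.2 (by positivity)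
  have h2 : Real.arctan (a / √ε) ≤ Real.arctan (b / √ε) :=
    Real.arctan_strictMono.monotone (by gcongr)
  have hπ := Real.pi_pos
  have hc : 0 < γ * (2 / Real.pi) := by positivity
  refine pow_le_pow_left₀ ?_ ?_ M
  · have h3 : γ * (2 / Real.pi) * (Real.pi / 2 - Real.arctan (a / √ε)) ≤
        γ * (2 / Real.pi) * (Real.pi / 2) := by gcongr; linarith
    have h4 : γ * (2 / Real.pi) * (Real.pi / 2) = γ := by field_simp
    linarith
  · gcongr

/-! ### The limit `α → 0+` -/

/-- The limit of `columnEta α x i` as `α → 0+`: the number of `t ≠ i` with `x t ≠ 0` and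
`ρ t = 1`. -/
noncomputable def columnCount (x : Fin N → ℝ) (i : Fin N) (ρ : Fin N → ℝ) : ℝ :=
  ∑ t ∈ Finset.univ.erase i, (if x t = 0 then 0 else 1) * ρ t

lemma columnCount_nonneg (x : Fin N → ℝ) (i : Fin N) {ρ : Fin N → ℝ}
    (hρ : ∀ t, ρ t = 0 ∨ ρ t = 1) : 0 ≤ columnCount x i ρ := by
  refine Finset.sum_nonneg fun t _ => ?_
  rcases hρ t with h | h <;> simp only [h] <;> split_ifs <;> simp

lemma tendsto_columnEta (x : Fin N → ℝ) (i : Fin N) (ρ : Fin N → ℝ) :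
    Tendsto (fun α => columnEta α x i ρ) (𝓝[>] 0) (𝓝 (columnCount x i ρ)) := by
  refine tendsto_finsetSum _ fun t _ => Tendsto.mul_const _ ?_
  split_ifs with ht
  · refine tendsto_const_nhds.congr' ?_
    filter_upwards [self_mem_nhdsWithin] with α hα
    rw [ht, Real.zero_rpow (ne_of_gt hα)]
  · have h := (Real.continuousAt_const_rpow (b := 0) ht).tendsto
    rw [Real.rpow_zero] at h
    exact h.mono_left nhdsWithin_le_nhds

lemma columnEta_eq_zero {x : Fin N → ℝ} {i : Fin N} {ρ : Fin N → ℝ}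
    (hρ : ∀ t, ρ t = 0 ∨ ρ t = 1) (h : columnCount x i ρ = 0) {α : ℝ} (hα : 0 < α) :
    columnEta α x i ρ = 0 := by
  have h1 := (Finset.sum_eq_zero_iff_of_nonneg (fun t _ => by
    rcases hρ t with h | h <;> simp only [h] <;> split_ifs <;> simp)).1 h
  refine Finset.sum_eq_zero fun t ht => ?_
  have h2 := h1 t ht
  by_cases hxt : x t = 0
  · simp [hxt, Real.zero_rpow hα.ne']
  · simp only [if_neg hxt, one_mul] at h2
    simp [h2]

/-- Dominated convergence over `ρ`. A zero count is treated separately because the ratio limit needs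
a positive parameter; there `η = 0` for every `α > 0` and the probability is already `1`. -/
theorem tendsto_integral_ratioProb (hst : ∀ α, 0 < α → α < 1 → IsMaxSkewedStable α (stableLaw α))
    (hγ0 : 0 < γ) (hγ1 : γ ≤ 1) {x : Fin N → ℝ} (hx : ∀ t, 0 ≤ x t) (i : Fin N) {ε : ℝ}
    (hε : 0 < ε) :
    Tendsto (fun α => ∫ ρ, ratioProb α ε (columnEta α x i ρ)
        ∂(Measure.pi fun _ : Fin N => bernoulliLaw γ)) (𝓝[>] 0)
      (𝓝 (∫ ρ, 1 / (1 + columnCount x i ρ)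
        ∂(Measure.pi fun _ : Fin N => bernoulliLaw γ))) := by
  have := isProbabilityMeasure_bernoulliLaw hγ0 hγ1
  refine tendsto_integral_filter_of_dominated_convergence (fun _ => 1) ?_ ?_
    (integrable_const _) ?_
  · filter_upwards [eventually_mem_Ioo_zero_one] with α hα
    exact ((measurable_ratioProb (hst α hα.1 hα.2) ε).comp
      (measurable_columnEta α x i)).aestronglyMeasurable
  · filter_upwards [eventually_mem_Ioo_zero_one] with α hα
    refine Eventually.of_forall fun ρ => ?_
    rw [Real.norm_eq_abs, abs_of_nonneg (ratioProb_nonneg _ _ _)]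
    exact ratioProb_le_one (hst α hα.1 hα.2) _ _
  · filter_upwards [ae_pi_bernoulliLaw hγ0 hγ1] with ρ hρ
    rcases (columnCount_nonneg x i hρ).eq_or_lt with h | h
    · rw [← h]
      refine tendsto_const_nhds.congr' ?_
      filter_upwards [eventually_mem_Ioo_zero_one] with α hα
      rw [columnEta_eq_zero hρ h.symm hα.1, ratioProb_zero hα.1 (hst α hα.1 hα.2) hε]
      norm_num
    · have hε0 : Tendsto (fun α : ℝ => ε ^ α) (𝓝[>] 0) (𝓝 1) := by
        have h := (Real.continuousAt_const_rpow (b := 0) hε.ne').tendsto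
        rw [Real.rpow_zero] at h
        exact h.mono_left nhdsWithin_le_nhds
      have hw := (tendsto_columnEta x i ρ).div hε0 one_ne_zero
      rw [div_one] at hw
      refine (tendsto_stableLaw_ratio hst h hw).congr' ?_
      filter_upwards [eventually_mem_Ioo_zero_one] with α hα
      rw [ratioProb_eq hα.1 hα.2 (hst α hα.1 hα.2) (columnEta_nonneg hx hρ α i) hε]
      rfl

/-- Jensen for `k ↦ 1/(1+k)` through its tangent line at `a = γκ`, which dominates the mean count;
the tangent decreases, so replacing the mean by `a` only loses. -/
theorem one_div_le_mul_integral_columnCount (hγ0 : 0 < γ) (hγ1 : γ ≤ 1) (x : Fin N → ℝ)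
    (i : Fin N) {κ : ℝ} (hκ : ∑ t ∈ Finset.univ.erase i, (if x t = 0 then 0 else 1 : ℝ) ≤ κ) :
    1 / (1 / γ + κ) ≤ γ * ∫ ρ, 1 / (1 + columnCount x i ρ)
      ∂(Measure.pi fun _ : Fin N => bernoulliLaw γ) := by
  have := isProbabilityMeasure_bernoulliLaw hγ0 hγ1
  have hae := ae_pi_bernoulliLaw (N := N) hγ0 hγ1
  set m := ∑ t ∈ Finset.univ.erase i, (if x t = 0 then 0 else 1 : ℝ) with hm
  have hm0 : 0 ≤ m := Finset.sum_nonneg fun t _ => by split_ifs <;> simp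
  have hκ0 : 0 ≤ κ := hm0.trans hκ
  set a := γ * κ with ha
  have ha0 : 0 ≤ a := by positivity
  have hcount : Integrable (columnCount x i) (Measure.pi fun _ : Fin N => bernoulliLaw γ) :=
    integrable_pi_bernoulliLaw hγ0 hγ1 _ _
  have hsub : Integrable (fun ρ => (columnCount x i ρ - a) / (1 + a) ^ 2)
      (Measure.pi fun _ : Fin N => bernoulliLaw γ) :=
    (hcount.sub (integrable_const _)).div_const _
  have hE : ∫ ρ, columnCount x i ρ ∂(Measure.pi fun _ : Fin N => bernoulliLaw γ) = γ * m :=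
    integral_pi_bernoulliLaw hγ0 hγ1 _ _
  have hcm : Measurable (columnCount x i) :=
    Finset.measurable_fun_sum _ fun t _ => by fun_prop
  have hint : Integrable (fun ρ => 1 / (1 + columnCount x i ρ))
      (Measure.pi fun _ : Fin N => bernoulliLaw γ) := by
    refine Integrable.mono' (integrable_const (1 : ℝ))
      (Measurable.aestronglyMeasurable (by fun_prop)) ?_
    filter_upwards [hae] with ρ hρ
    have := columnCount_nonneg x i hρ
    rw [Real.norm_eq_abs, abs_of_nonneg (by positivity), div_le_one (by positivity)]
    linarith
  have htan : ∫ ρ, (1 / (1 + a) - (columnCount x i ρ - a) / (1 + a) ^ 2)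
      ∂(Measure.pi fun _ : Fin N => bernoulliLaw γ) ≤
      ∫ ρ, 1 / (1 + columnCount x i ρ) ∂(Measure.pi fun _ : Fin N => bernoulliLaw γ) := by
    refine integral_mono_ae ((integrable_const _).sub hsub) hint ?_
    filter_upwards [hae] with ρ hρ
    have hk := columnCount_nonneg x i hρ
    generalize columnCount x i ρ = k at hk ⊢
    -- The gap between the function and its tangent line is an explicit square over a positive
    -- quantity.
    have : 1 / (1 + k) - (1 / (1 + a) - (k - a) / (1 + a) ^ 2) =
        (k - a) ^ 2 / ((1 + k) * (1 + a) ^ 2) := by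
      field_simp
      ring
    have h2 : 0 ≤ (k - a) ^ 2 / ((1 + k) * (1 + a) ^ 2) := by positivity
    linarith
  have hlin : ∫ ρ, (1 / (1 + a) - (columnCount x i ρ - a) / (1 + a) ^ 2)
      ∂(Measure.pi fun _ : Fin N => bernoulliLaw γ) =
      1 / (1 + a) - (γ * m - a) / (1 + a) ^ 2 := by
    rw [integral_sub (integrable_const _) hsub, integral_div (r := (1 + a) ^ 2),
      integral_sub hcount (integrable_const _), hE]
    simp
  have hle : 1 / (1 + a) ≤ 1 / (1 + a) - (γ * m - a) / (1 + a) ^ 2 := by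
    have h1 : γ * m ≤ a := by rw [ha]; gcongr
    have : 0 ≤ (a - γ * m) / (1 + a) ^ 2 := div_nonneg (by linarith) (by positivity)
    have h3 : (γ * m - a) / (1 + a) ^ 2 = -((a - γ * m) / (1 + a) ^ 2) := by ring
    linarith
  have hval : 1 / (1 / γ + κ) = γ * (1 / (1 + a)) := by
    rw [ha]
    field_simp
  rw [hval]
  exact mul_le_mul_of_nonneg_left (hle.trans (hlin ▸ htan)) hγ0.le

lemma integral_columnCount_le_one (hγ0 : 0 < γ) (hγ1 : γ ≤ 1) (x : Fin N → ℝ) (i : Fin N) :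
    ∫ ρ, 1 / (1 + columnCount x i ρ) ∂(Measure.pi fun _ : Fin N => bernoulliLaw γ) ≤ 1 := by
  have := isProbabilityMeasure_bernoulliLaw hγ0 hγ1
  have h := norm_integral_le_of_norm_le_const
    (μ := Measure.pi fun _ : Fin N => bernoulliLaw γ) (C := 1)
    (f := fun ρ => 1 / (1 + columnCount x i ρ)) (by
      filter_upwards [ae_pi_bernoulliLaw hγ0 hγ1] with ρ hρ
      have := columnCount_nonneg x i hρ
      rw [Real.norm_eq_abs, abs_of_nonneg (by positivity), div_le_one (by positivity)]
      linarith)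
  simp only [probReal_univ, mul_one] at h
  exact (le_abs_self _).trans h

lemma sum_support_erase_le {K : ℕ} {x : Fin N → ℝ}
    (hK : (Finset.univ.filter fun t => x t ≠ 0).card ≤ K) (i : Fin N) :
    ∑ t ∈ Finset.univ.erase i, (if x t = 0 then 0 else 1 : ℝ) ≤
      (K : ℝ) - 1 + (if x i = 0 then 1 else 0) := by
  have h1 : ∑ t, (if x t = 0 then 0 else 1 : ℝ) ≤ K := by
    have h2 : ∑ t, (if x t = 0 then 0 else 1 : ℝ) =
        (Finset.univ.filter fun t => x t ≠ 0).card := by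
      rw [Finset.card_filter]
      push_cast
      exact Finset.sum_congr rfl fun t _ => by by_cases h : x t = 0 <;> simp [h]
    rw [h2]
    exact_mod_cast hK
  rw [← Finset.add_sum_erase _ _ (Finset.mem_univ i)] at h1
  split_ifs at h1 ⊢ <;> linarith

end Bounds

lemma limit_bound_pow_mono {N K : ℕ} {γ : ℝ} {x : Fin N → ℝ}
    (hK : (Finset.univ.filter fun t => x t ≠ 0).card ≤ K) (hγ0 : 0 < γ) (hγ1 : γ ≤ 1)
    (i : Fin N) (M : ℕ) :
    (1 - 1 / (1 / γ + (K : ℝ) - 1 + (if x i = 0 then 1 else 0))) ^ M ≤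
      (1 - 1 / (1 / γ + (K : ℝ))) ^ M := by
  have h1 : (0 : ℝ) ≤ (K : ℝ) - 1 + (if x i = 0 then 1 else 0) :=
    (Finset.sum_nonneg fun t _ => by split_ifs <;> simp).trans (sum_support_erase_le hK i)
  have h2 : 1 ≤ 1 / γ := (one_le_div hγ0).2 hγ1
  have h3 : 1 ≤ 1 / γ + (K : ℝ) - 1 + (if x i = 0 then 1 else 0) := by linarith
  have h4 : 1 / γ + (K : ℝ) - 1 + (if x i = 0 then 1 else 0) ≤ 1 / γ + (K : ℝ) := by
    split_ifs <;> linarith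
  refine pow_le_pow_left₀ ?_ ?_ M
  · rw [sub_nonneg, div_le_one (by linarith)]
    exact h3
  · have := one_div_le_one_div_of_le (by linarith) h4
    linarith

end CompressedCounting

/-! ### Assembly of the three claims -/

theorem mainTheorem3 {N M : ℕ} (K : ℕ) (x : Fin N → ℝ) (hx : ∀ t, 0 ≤ x t)
    (hK : (Finset.univ.filter fun t => x t ≠ 0).card ≤ K)
    (γ : ℝ) (hγ0 : 0 < γ) (hγ1 : γ ≤ 1) (ε : ℝ) (hε : 0 < ε) (i : Fin N) :
    -- the general formula
    (∀ (α : ℝ), 0 < α → α < 1 →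
      ∀ (Ω : Type*) [MeasurableSpace Ω] (P : Measure Ω) (s r : Fin N → Fin M → Ω → ℝ),
        CompressedCounting.IsSparseDesign α γ P s r →
        ∀ j : Fin M,
          CompressedCounting.errorProb P x s r i ε =
            (1 - γ * ∫ ω, CompressedCounting.ratioCDF α
              ((ENNReal.ofReal (ε ^ α) /
                ENNReal.ofReal (CompressedCounting.eta α x r i j ω)) ^ (1 / (1 - α))) ∂P) ^ M) ∧
    -- the limit `α → 0+`
    (∀ (Ω : ℝ → Type*) [∀ α, MeasurableSpace (Ω α)] (P : ∀ α, Measure (Ω α))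
        (s r : ∀ α, Fin N → Fin M → Ω α → ℝ),
        (∀ α, 0 < α → α < 1 → CompressedCounting.IsSparseDesign α γ (P α) (s α) (r α)) →
        ∃ L : ℝ,
          Tendsto (fun α => CompressedCounting.errorProb (P α) x (s α) (r α) i ε)
            (𝓝[>] 0) (𝓝 L) ∧
          L ≤ (1 - 1 / (1 / γ + (K : ℝ) - 1 + (if x i = 0 then 1 else 0))) ^ M ∧
          (1 - 1 / (1 / γ + (K : ℝ) - 1 + (if x i = 0 then 1 else 0))) ^ M ≤
            (1 - 1 / (1 / γ + (K : ℝ))) ^ M) ∧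
    -- the case `α = 1/2`
    (∀ (Ω : Type*) [MeasurableSpace Ω] (P : Measure Ω) (s r : Fin N → Fin M → Ω → ℝ),
        CompressedCounting.IsSparseDesign (1 / 2) γ P s r →
        CompressedCounting.errorProb P x s r i ε ≤
          (1 - γ * (2 / Real.pi) * CompressedCounting.arctanTop
            (ENNReal.ofReal (Real.sqrt ε) /
              ENNReal.ofReal (γ * ∑ t ∈ Finset.univ.erase i, x t ^ (1 / 2 : ℝ)))) ^ M ∧
        (1 - γ * (2 / Real.pi) * CompressedCounting.arctanTop
            (ENNReal.ofReal (Real.sqrt ε) /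
              ENNReal.ofReal (γ * ∑ t ∈ Finset.univ.erase i, x t ^ (1 / 2 : ℝ)))) ^ M ≤
          (1 - γ * (2 / Real.pi) * CompressedCounting.arctanTop
            (ENNReal.ofReal (Real.sqrt ε) /
              ENNReal.ofReal (γ * ∑ t, x t ^ (1 / 2 : ℝ)))) ^ M) := by
  refine ⟨?_, ?_, ?_⟩
  · intro α h0 h1 Ω _ P s r h j
    have hS : CompressedCounting.IsMaxSkewedStable α (CompressedCounting.stableLaw α) := by
      have h2 := h.law_s i j
      rwa [h2.eq_stableLaw] at h2
    rw [h.errorProb_eq hγ0 hγ1 h0 h1 hS hx i ε, h.integral_ratioCDF hγ0 hγ1 h0 h1 hS hx i hε j]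
  · intro Ω _ P s r h
    have hpow := CompressedCounting.limit_bound_pow_mono hK hγ0 hγ1 i M
    -- With no columns the design provides no variable of law `S(α,1,1)`, hence no existence of that
    -- law; but the estimator is then `⊤` and the error probability is `1`.
    rcases M.eq_zero_or_pos with rfl | hM
    · refine ⟨1, ?_, by simp, hpow⟩
      refine tendsto_const_nhds.congr' ?_
      filter_upwards [CompressedCounting.eventually_mem_Ioo_zero_one] with α hα
      have := (h α hα.1 hα.2).isProbabilityMeasure
      have hset : {ω | ((x i + ε : ℝ) : EReal) < CompressedCounting.estimator x (s α) (r α) i ω} =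
          Set.univ := by
        refine Set.eq_univ_of_forall fun ω => ?_
        rw [Set.mem_ofPred_eq, CompressedCounting.lt_estimator_iff]
        exact fun j => j.elim0
      rw [CompressedCounting.errorProb, hset, probReal_univ]
    · have hst : ∀ α, 0 < α → α < 1 →
          CompressedCounting.IsMaxSkewedStable α (CompressedCounting.stableLaw α) := by
        intro α h0 h1
        have h2 := (h α h0 h1).law_s i ⟨0, hM⟩
        rwa [h2.eq_stableLaw] at h2
      have hlim := ((CompressedCounting.tendsto_integral_ratioProb hst hγ0 hγ1 hx i hε).const_mul
        γ).const_sub 1 |>.pow M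
      refine ⟨_, hlim.congr' ?_, ?_, hpow⟩
      · filter_upwards [CompressedCounting.eventually_mem_Ioo_zero_one] with α hα
        exact ((h α hα.1 hα.2).errorProb_eq hγ0 hγ1 hα.1 hα.2 (hst α hα.1 hα.2) hx i ε).symm
      · have h1 := CompressedCounting.integral_columnCount_le_one hγ0 hγ1 x i
        have h2 := CompressedCounting.one_div_le_mul_integral_columnCount hγ0 hγ1 x i
          (CompressedCounting.sum_support_erase_le hK i)
        rw [← add_assoc, ← add_sub_assoc] at h2
        -- Monotonicity of the power needs a nonnegative base, which is why the mean was bounded by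
        -- `1`.
        refine pow_le_pow_left₀ ?_ ?_ M
        · nlinarith
        · linarith
  · intro Ω _ P s r h
    have hnn : ∀ t, 0 ≤ x t ^ (1 / 2 : ℝ) := fun t => Real.rpow_nonneg (hx t) _
    refine ⟨CompressedCounting.errorProb_half_le hγ0 hγ1 hx i hε h,
      CompressedCounting.one_sub_arctanTop_pow_mono hγ0 hγ1 hε
        (mul_nonneg hγ0.le (Finset.sum_nonneg fun t _ => hnn t)) ?_ M⟩
    exact mul_le_mul_of_nonneg_left
      (Finset.sum_le_sum_of_subset_of_nonneg (Finset.erase_subset _ _) fun t _ _ => hnn t) hγ0.le
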